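/- **Setting.** Let $\ell^2(\mathbb N)$ be the complex Hilbert space with canonical basis $(e_j)$. Let $F$ be a unitary operator on $\ell^2(\mathbb N)$ and $p$ a probability distribution on $\mathbb N$. Let $s_1,\dots,s_m$ be i.i.d. random vectors with $\mathbb P(s_i=e_j)=p_j$, and put $(Sx)_i=\langle x,s_i\rangle\in\mathbb C$ for $i=1,\dots,m$. Put $(Dx)_j=x_j/\sqrt{p_j}$ if $p_j>0$ and $(Dx)_j=0$ if $p_j=0$ ($D$ takes values in the space of all complex sequences), and $\hat I=\mathrm{diag}(\mathbf 1_{\operatorname{supp}p})$. A *$(k,d)$-generalized generative network* is given by integers $2\le k=k_0\le k_1\le\dots\le k_d$, matrices $W^{(i)}\in\mathbb C^{k_i\times k_{i-1}}$ and a linear map $W\colon\mathbb C^{k_d}\to\ell^2(\mathbb N)$; it is the map $$G(z)=W\,\sigma\bigl(W^{(d)}\sigma(\cdots W^{(2)}\sigma(W^{(1)}z))\bigr),\qquad z\in\mathbb R^k,$$ where $\sigma$ is the ReLU, $\sigma(x)=\max(0,x)$ for real $x$, applied to each coordinate and, for complex coordinates, to the real and the imaginary part: $\sigma(x+iy)=\max(0,x)+i\max(0,y)$.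 Let $R(G)$ be its range and $\mathcal T=R(G)-R(G)=\{a-b: a,b\in R(G)\}$; $\mathcal T$ is a finite union of convex cones. For a finite union of convex cones $\mathcal U=\bigcup_i\mathcal C_i$ contained in a finite-dimensional subspace of $\ell^2(\mathbb N)$, let $\Delta(\mathcal U)=\bigcup_i\operatorname{span}_{\mathbb C}(\mathcal C_i)$ (this set does not depend on the choice of the cones), let $\alpha_j=\sup\{|(Fx)_j| : x\in\Delta(\mathcal U),\ \|x\|=1\}$, and let $\mu_{\mathcal U}(F,p)$ be the smallest constant with $\alpha_j\le\mu_{\mathcal U}(F,p)\sqrt{p_j}$ for all $j$ with $p_j>0$ (it is assumed to be finite). **Theorem 4.3 (Gen-RIP).** Let $G$ be a $(k,d)$-generalized generative network with $\mu_{\mathcal T}(F,p)\ge 1$, and let $\varepsilon>0$, $\delta\in(0,1)$. If $$m\ \ge\ \frac{4\,\mu_{\mathcal T}(F,p)^2}{\delta^2}\left[2kd\log\!\left(\frac{2e\,k_d}{k}\right)+\log\!\left(\frac{4k}{\varepsilon}\right)\right],$$ then, with probability at least $1-\varepsilon$, $$\sup_{x\in\mathcal T,\ \|x\|=1}\left|\frac1m\|SDFx\|^2-\|\hat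 IFx\|^2\right|\le\delta .$$ -/

import Mathlib

open scoped Pointwise
open MeasureTheory ProbabilityTheory

noncomputable section

namespace GenRIP

/-- The complex Hilbert space `ℓ²(ℕ)`. -/
abbrev Ell2 : Type := lp (fun _ : ℕ => ℂ) 2

/-! ### Generalized generative networks -/

/-- ReLU. On real numbers it is `x ↦ max 0 x`; a complex preactivation is treated through its real
and imaginary parts. -/
def relu (z : ℂ) : ℂ := ⟨max 0 z.re, max 0 z.im⟩

lemma relu_ofReal (x : ℝ) : relu (x : ℂ) = ((max 0 x : ℝ) : ℂ) := by
  apply Complex.ext <;> simp [relu]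

/-- The data of a `(k, d)`-generalized generative network: widths `2 ≤ k = k₀ ≤ k₁ ≤ ⋯ ≤ k_d`,
complex weight matrices `W⁽ⁱ⁺¹⁾ ∈ ℂ^(kᵢ₊₁ × kᵢ)` (`weight i`) and a final linear map `ℂ^(k_d) → ℓ²(ℕ)`.
Only `width i` for `i ≤ d` and `weight i` for `i < d` are ever used. -/
structure GenerativeNetwork (k d : ℕ) where
  width : ℕ → ℕ
  two_le : 2 ≤ k
  width_zero : width 0 = k
  width_mono : ∀ i < d, width i ≤ width (i + 1)
  weight : ∀ i : ℕ, Matrix (Fin (width (i + 1))) (Fin (width i)) ℂ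
  final : (Fin (width d) → ℂ) →ₗ[ℂ] Ell2

namespace GenerativeNetwork

variable {k d : ℕ}

/-- The output of the first `i` layers on the latent vector `z ∈ ℝᵏ`. -/
def hidden (G : GenerativeNetwork k d) (z : Fin (G.width 0) → ℝ) :
    (i : ℕ) → Fin (G.width i) → ℂ
  | 0 => fun j => (z j : ℂ)
  | i + 1 => fun j => relu (((G.weight i).mulVec (hidden G z i)) j)

/-- `G(z) = W σ(W⁽ᵈ⁾ σ(⋯ σ(W⁽¹⁾ z)))`. -/
def eval (G : GenerativeNetwork k d) (z : Fin (G.width 0) → ℝ) : Ell2 :=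
  G.final (G.hidden z d)

/-- The range `R(G)`. -/
def range (G : GenerativeNetwork k d) : Set Ell2 := Set.range G.eval

/-- `𝒯 = R(G) - R(G) = {a - b | a, b ∈ R(G)}`. -/
def differenceSet (G : GenerativeNetwork k d) : Set Ell2 := G.range - G.range

end GenerativeNetwork

/-! ### Sampling, weighting and projection operators

`D` may be unbounded on `ℓ²(ℕ)`: its values are sequences that need not be square summable.  Hence `D`
and `S` act on all sequences `ℕ → ℂ`; `S` only reads finitely many coordinates. -/

/-- The sampling operator for the vectors `sᵢ = e_{J i}`: `(S x)ᵢ = ⟨x, e_{J i}⟩ = x_{J i}`. -/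
def samplingOp {m : ℕ} (J : Fin m → ℕ) : (ℕ → ℂ) →ₗ[ℂ] EuclideanSpace ℂ (Fin m) where
  toFun x := WithLp.toLp 2 fun i => x (J i)
  map_add' _ _ := rfl
  map_smul' _ _ := rfl

/-- The weighting operator: `(D x)ⱼ = xⱼ / √pⱼ` if `pⱼ > 0`, and `0` if `pⱼ = 0`. -/
def weightOp (p : PMF ℕ) : (ℕ → ℂ) →ₗ[ℂ] (ℕ → ℂ) where
  toFun x j := if 0 < p j then x j / (Real.sqrt (p j).toReal : ℂ) else 0
  map_add' x y := by
    funext j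
    by_cases h : 0 < p j <;> simp [h, add_div]
  map_smul' c x := by
    funext j
    by_cases h : 0 < p j <;> simp [h, mul_div_assoc]

/-- The diagonal projection `Î = diag(1_{supp p})` of `ℓ²(ℕ)`. -/
def supportProj (p : PMF ℕ) : Ell2 →ₗ[ℂ] Ell2 where
  toFun x := ⟨fun j => if 0 < p j then x j else 0, by
    refine (lp.memℓp x).mono' ?_
    intro j
    by_cases h : 0 < p j <;> simp [h]⟩
  map_add' x y := by
    ext j
    change (if 0 < p j then x j + y j else 0) =
      (if 0 < p j then x j else 0) + (if 0 < p j then y j else 0)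
    by_cases h : 0 < p j <;> simp [h]
  map_smul' c x := by
    ext j
    by_cases h : 0 < p j <;> simp [h]

/-! ### Local coherence -/

/-- `Δ(𝒰)` for a finite union of convex cones `𝒰 = C₁ ∪ ⋯ ∪ C_N`: the union of the linear spans of
the cones.  Written as the union of the spans of all convex cones contained in `𝒰`; by
`coneSpan_iUnion` this is `span C₁ ∪ ⋯ ∪ span C_N` for every choice of the finitely many cones, so it
does not depend on the decomposition. -/
def coneSpan (U : Set Ell2) : Set Ell2 :=
  {x | ∃ C : ConvexCone ℝ Ell2, (C : Set Ell2) ⊆ U ∧ x ∈ Submodule.span ℂ (C : Set Ell2)}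

/-- The local coherence `αᵢ = sup {|(F x)ᵢ| : x ∈ Δ(𝒰), ‖x‖ = 1}`, where `(F x)ᵢ = ⟨x, F* eᵢ⟩`. -/
def localCoherence (F : Ell2 ≃ₗᵢ[ℂ] Ell2) (U : Set Ell2) (i : ℕ) : ℝ :=
  ⨆ x : {x : Ell2 // x ∈ coneSpan U ∧ ‖x‖ = 1}, ‖(F x.1 : Ell2) i‖

/-- The admissible constants in `αⱼ ≤ c √pⱼ` for all `j` with `pⱼ > 0`. -/
def coherenceBounds (F : Ell2 ≃ₗᵢ[ℂ] Ell2) (U : Set Ell2) (p : PMF ℕ) : Set ℝ :=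
  {c | ∀ j, 0 < p j → localCoherence F U j ≤ c * Real.sqrt (p j).toReal}

/-- `μ_𝒰(F, p)`, the smallest constant `c` with `αⱼ ≤ c √pⱼ` for all `j` with `pⱼ > 0`.  It is
attained as soon as there is such a constant (`isLeast_mu`).  If there is none (`μ = ∞`), this real
number is `0`, which the assumption `1 ≤ μ` rules out. -/
def mu (F : Ell2 ≃ₗᵢ[ℂ] Ell2) (U : Set Ell2) (p : PMF ℕ) : ℝ := sInf (coherenceBounds F U p)

/-- `sup_{x ∈ K, ‖x‖ = 1} |(1/m) ‖S D F x‖² - ‖Î F x‖²| ≤ δ`, for the sampled indices `J`. -/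
def SatisfiesGenRIP {m : ℕ} (F : Ell2 ≃ₗᵢ[ℂ] Ell2) (p : PMF ℕ) (J : Fin m → ℕ) (K : Set Ell2)
    (δ : ℝ) : Prop :=
  ∀ x ∈ K, ‖x‖ = 1 →
    |(1 / (m : ℝ)) * ‖samplingOp J (weightOp p (F x : ℕ → ℂ))‖ ^ 2 - ‖supportProj p (F x)‖ ^ 2| ≤ δ

/-! ### The definitions agree with their descriptions -/

lemma cone_subset_of_cover {N : ℕ} (V : Fin N → Submodule ℂ Ell2) (C : ConvexCone ℝ Ell2)
    (hne : (C : Set Ell2).Nonempty) (hC : (C : Set Ell2) ⊆ ⋃ i, (V i : Set Ell2)) :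
    ∃ i, (C : Set Ell2) ⊆ V i := by
  classical
  let I : Ell2 → Finset (Fin N) := fun x => Finset.univ.filter fun i => x ∈ V i
  obtain ⟨x, hx, hmin⟩ : ∃ x ∈ (C : Set Ell2), ∀ y ∈ (C : Set Ell2), (I x).card ≤ (I y).card := by
    have := (measure (fun x : Ell2 => (I x).card)).wf.has_min (C : Set Ell2) hne
    obtain ⟨x, hx, h⟩ := this
    exact ⟨x, hx, fun y hy => not_lt.1 (h y hy)⟩
  obtain ⟨i, hi⟩ := Set.mem_iUnion.1 (hC hx)
  refine ⟨i, fun y hy => ?_⟩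
  -- for each index `l` with `x ∉ V l`, at most one `t` satisfies `x + t y ∈ V l`
  let B : Set ℝ := ⋃ l ∈ {l : Fin N | x ∉ V l}, {t : ℝ | x + t • y ∈ V l}
  have hB : B.Finite := by
    refine Set.Finite.biUnion (Set.toFinite _) fun l hl => Set.Subsingleton.finite ?_
    intro s hs t ht
    by_contra hst
    apply hl
    have h1 : t • (x + s • y) - s • (x + t • y) ∈ V l := by
      refine (V l).sub_mem ?_ ?_
      · exact ((V l).restrictScalars ℝ).smul_mem t hs
      · exact ((V l).restrictScalars ℝ).smul_mem s ht
    have h2 : t • (x + s • y) - s • (x + t • y) = (t - s) • x := by module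
    rw [h2] at h1
    have h3 := ((V l).restrictScalars ℝ).smul_mem (t - s)⁻¹ h1
    rwa [smul_smul, inv_mul_cancel₀ (sub_ne_zero.2 (Ne.symm hst)), one_smul] at h3
  obtain ⟨t, ht0, htB⟩ : ∃ t ∈ Set.Ioi (0 : ℝ), t ∉ B :=
    (Set.Ioi_infinite (0 : ℝ)).exists_notMem_finite hB
  have hz : x + t • y ∈ (C : Set Ell2) := C.add_mem hx (C.smul_mem ht0 hy)
  have hsub : I (x + t • y) ⊆ I x := by
    intro l hl
    simp only [I, Finset.mem_filter, Finset.mem_univ, true_and] at hl ⊢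
    by_contra hxl
    exact htB (Set.mem_biUnion (show l ∈ {l : Fin N | x ∉ V l} from hxl) hl)
  have heq := Finset.eq_of_subset_of_card_le hsub (hmin _ hz)
  have hiz : x + t • y ∈ V i := by
    have : i ∈ I (x + t • y) := by
      rw [heq]
      simpa [I] using hi
    simpa [I] using this
  have h1 : t • y ∈ V i := by simpa using (V i).sub_mem hiz hi
  have h2 := ((V i).restrictScalars ℝ).smul_mem t⁻¹ h1
  rwa [smul_smul, inv_mul_cancel₀ (ne_of_gt ht0), one_smul] at h2

/-- For every decomposition of a set into finitely many nonempty convex cones,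
`Δ(C₁ ∪ ⋯ ∪ C_N) = span C₁ ∪ ⋯ ∪ span C_N`. -/
theorem coneSpan_iUnion {N : ℕ} (C : Fin N → ConvexCone ℝ Ell2)
    (hC : (⋃ i, (C i : Set Ell2)).Nonempty) :
    coneSpan (⋃ i, (C i : Set Ell2)) = ⋃ i, (Submodule.span ℂ (C i : Set Ell2) : Set Ell2) := by
  ext x
  constructor
  · rintro ⟨K, hK, hx⟩
    rcases (K : Set Ell2).eq_empty_or_nonempty with h0 | hne
    · rw [h0, Submodule.span_empty, Submodule.mem_bot] at hx
      obtain ⟨_, hy⟩ := hC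
      obtain ⟨i, _⟩ := Set.mem_iUnion.1 hy
      exact Set.mem_iUnion.2 ⟨i, hx ▸ Submodule.zero_mem _⟩
    · obtain ⟨i, hi⟩ := cone_subset_of_cover (fun i => Submodule.span ℂ (C i : Set Ell2)) K hne
        (hK.trans (Set.iUnion_mono fun i => Submodule.subset_span))
      exact Set.mem_iUnion.2 ⟨i, Submodule.span_le.2 hi hx⟩
  · intro hx
    obtain ⟨i, hi⟩ := Set.mem_iUnion.1 hx
    exact ⟨C i, Set.subset_iUnion (fun i => (C i : Set Ell2)) i, hi⟩

lemma isLeast_mu (F : Ell2 ≃ₗᵢ[ℂ] Ell2) (U : Set Ell2) (p : PMF ℕ)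
    (h : (coherenceBounds F U p).Nonempty) : IsLeast (coherenceBounds F U p) (mu F U p) := by
  have hnn : ∀ j, 0 ≤ localCoherence F U j := fun j => Real.iSup_nonneg fun _ => norm_nonneg _
  have hpos : ∀ j, 0 < p j → 0 < Real.sqrt (p j).toReal := fun j hj =>
    Real.sqrt_pos.2 (ENNReal.toReal_pos hj.ne' (p.apply_ne_top j))
  have hbdd : BddBelow (coherenceBounds F U p) := by
    refine ⟨0, fun c hc => ?_⟩
    obtain ⟨j, hj⟩ := p.support_nonempty
    have hj' : 0 < p j := pos_iff_ne_zero.2 ((p.mem_support_iff j).1 hj)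
    exact nonneg_of_mul_nonneg_left ((hnn j).trans (hc j hj')) (hpos j hj')
  refine ⟨fun j hj => ?_, fun c hc => csInf_le hbdd hc⟩
  rw [← div_le_iff₀ (hpos j hj)]
  refine le_csInf h fun c hc => ?_
  rw [div_le_iff₀ (hpos j hj)]
  exact hc j hj

end GenRIP

end

/-! A ReLU network is piecewise linear, so the difference set is covered by finitely many convex
cones. The estimate is proved on the complex span of each cone, and a union bound finishes.

Counting (`exists_cone_cover`): each layer cuts the real `k`-dimensional latent space by the signs
of at most `2 k_d` real functionals. By Sauer–Shelah this gives at most `(2 e k_d / k)^k` patterns.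
Over `d` layers and over pairs of pieces there are at most `(2 e k_d / k)^(2 k d)` cones, each with
complex span of dimension at most `2 k`. The cones lie inside the difference set, so the coherence
controls their spans.

One span (`measure_not_satisfiesGenRIP_le`): in orthonormal coordinates, `(1/m) ‖S D F x‖²` is the
quadratic form of an average of i.i.d. rank-one matrices `X` with `0 ≤ X ≤ μ²`. Their mean has
quadratic form `‖Î F x‖²`, so it is at most `1`. The matrix Chernoff bound `measure_deviation_gt_le`
gives failure probability at most `2 · 2k · exp (-m δ² / (4 μ²))`. It follows the Ahlswede–Winter
method: Markov's inequality for `tr exp`, with `golden_thompson` separating the samples.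

The two terms in the bracket of the sample bound absorb the number of cones and the factor `4 k`. -/

noncomputable section

namespace GenRIP

/-! ### The Golden–Thompson inequality. -/

section GoldenThompson

open Matrix
open scoped Matrix.Norms.L2Operator MatrixOrder ComplexOrder

lemma isHermitian_real_smul {n : Type*} {A : Matrix n n ℂ} (hA : A.IsHermitian) (t : ℝ) :
    (t • A).IsHermitian := by
  rw [IsHermitian, conjTranspose_smul, hA.eq, star_trivial]

variable {n : Type} [Fintype n]

lemma re_trace_mul_comm (A B : Matrix n n ℂ) : (A * B).trace.re = (B * A).trace.re := by
  rw [trace_mul_comm]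

lemma re_trace_conjTranspose (A : Matrix n n ℂ) : Aᴴ.trace.re = A.trace.re := by
  simp [trace_conjTranspose]

/-- Expand the squared Frobenius norm of `M - Mᴴ`, which is nonnegative. -/
lemma re_trace_mul_self_le (M : Matrix n n ℂ) : (M * M).trace.re ≤ (M * Mᴴ).trace.re := by
  have h := (posSemidef_self_mul_conjTranspose (M - Mᴴ)).trace_nonneg
  have h0 := (Complex.le_def.1 h).1
  have e : (M - Mᴴ) * (M - Mᴴ)ᴴ = M * Mᴴ - M * M - (M * M)ᴴ + Mᴴ * M := by
    simp only [conjTranspose_sub, conjTranspose_conjTranspose, conjTranspose_mul]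
    noncomm_ring
  rw [e] at h0
  simp only [trace_add, trace_sub, Complex.add_re, Complex.sub_re, Complex.zero_re,
    re_trace_conjTranspose, re_trace_mul_comm Mᴴ M] at h0
  linarith

lemma two_mul_re_trace_mul_le {P Q : Matrix n n ℂ} (hP : P.IsHermitian) (hQ : Q.IsHermitian) :
    2 * (P * Q).trace.re ≤ (P * P).trace.re + (Q * Q).trace.re := by
  have h := (posSemidef_self_mul_conjTranspose (P - Q)).trace_nonneg
  have h0 := (Complex.le_def.1 h).1
  have e : (P - Q) * (P - Q)ᴴ = P * P - P * Q - Q * P + Q * Q := by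
    rw [conjTranspose_sub, hP.eq, hQ.eq]
    noncomm_ring
  rw [e] at h0
  simp only [trace_add, trace_sub, Complex.add_re, Complex.sub_re, Complex.zero_re,
    re_trace_mul_comm Q P] at h0
  linarith

variable [DecidableEq n]

/-- Cyclicity of the trace on powers of a product. -/
lemma trace_mul_pow_comm (A B : Matrix n n ℂ) (N : ℕ) :
    ((A * B) ^ N).trace = ((B * A) ^ N).trace := by
  cases N with
  | zero => simp
  | succ N =>
    have h : (A * B) ^ (N + 1) = A * ((B * A) ^ N * B) := by
      induction N with
      | zero => simp
      | succ N ih => rw [pow_succ, ih, pow_succ (B * A)]; noncomm_ring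
    rw [h, trace_mul_comm, pow_succ, mul_assoc]

/-- Two trace inequalities for powers with exponent `2 ^ l`, proved together by induction. -/
lemma re_trace_pow_two_pow_aux (l : ℕ) :
    (∀ P Q : Matrix n n ℂ, P.IsHermitian → Q.IsHermitian →
      ((P * Q) ^ 2 ^ l).trace.re ≤ (P ^ 2 ^ l * Q ^ 2 ^ l).trace.re) ∧
    (∀ X : Matrix n n ℂ,
      (X ^ 2 ^ l * Xᴴ ^ 2 ^ l).trace.re ≤ ((X * Xᴴ) ^ 2 ^ l).trace.re) := by
  induction l with
  | zero => simp
  | succ l ih =>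
    obtain ⟨hT, hQ⟩ := ih
    constructor
    · intro P Q hP hQ'
      -- Split the power as a square, then use the second inequality at level `l` for `X = P Q`.
      -- Cyclicity turns `P Q² P` into `P² Q²`, to which the first inequality applies.
      have h1 : ((P * Q) ^ 2 ^ (l + 1)).trace.re ≤ (((P * Q) * (P * Q)ᴴ) ^ 2 ^ l).trace.re := by
        refine le_trans ?_ (hQ (P * Q))
        have := re_trace_mul_self_le ((P * Q) ^ 2 ^ l)
        rwa [conjTranspose_pow, ← pow_add, ← two_mul, ← pow_succ'] at this
      refine h1.trans ?_
      have h2 : (((P * Q) * (P * Q)ᴴ) ^ 2 ^ l).trace = ((P ^ 2 * Q ^ 2) ^ 2 ^ l).trace := by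
        rw [conjTranspose_mul, hP.eq, hQ'.eq,
          show P * Q * (Q * P) = (P * Q ^ 2) * P by noncomm_ring, trace_mul_pow_comm,
          show P * (P * Q ^ 2) = P ^ 2 * Q ^ 2 by noncomm_ring]
      rw [h2]
      refine (hT _ _ (hP.pow 2) (hQ'.pow 2)).trans (le_of_eq ?_)
      rw [← pow_mul, ← pow_mul, ← pow_succ']
    · intro X
      -- Starting from `X²`, cyclicity produces the product of the Hermitian matrices `Xᴴ X` and `X
      -- Xᴴ`. The first inequality separates their powers, and `2 Re tr (PQ) ≤ Re tr P² + Re tr Q²`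
      -- recombines them, since `Xᴴ X` and `X Xᴴ` have equal traces of powers.
      have h1 := hQ (X * X)
      have e1 : (X * X) ^ 2 ^ l = X ^ 2 ^ (l + 1) := by rw [← pow_two, ← pow_mul, ← pow_succ']
      have e2 : (X * X)ᴴ ^ 2 ^ l = Xᴴ ^ 2 ^ (l + 1) := by
        rw [conjTranspose_mul, ← pow_two, ← pow_mul, ← pow_succ']
      rw [e1, e2] at h1
      refine h1.trans ?_
      have e3 : ((X * X * (X * X)ᴴ) ^ 2 ^ l).trace = (((Xᴴ * X) * (X * Xᴴ)) ^ 2 ^ l).trace := by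
        rw [conjTranspose_mul, show X * X * (Xᴴ * Xᴴ) = (X * (X * Xᴴ)) * Xᴴ by noncomm_ring,
          trace_mul_pow_comm, ← mul_assoc Xᴴ X]
      rw [e3]
      have hP : (Xᴴ * X).IsHermitian := isHermitian_conjTranspose_mul_self X
      have hP' : (X * Xᴴ).IsHermitian := isHermitian_mul_conjTranspose_self X
      refine (hT _ _ hP hP').trans ?_
      have h2 := two_mul_re_trace_mul_le (hP.pow (2 ^ l)) (hP'.pow (2 ^ l))
      rw [← pow_add, ← pow_add, ← two_mul, ← pow_succ', trace_mul_pow_comm Xᴴ X] at h2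
      linarith

lemma re_trace_mul_pow_two_pow_le {P Q : Matrix n n ℂ} (hP : P.IsHermitian) (hQ : Q.IsHermitian)
    (l : ℕ) : ((P * Q) ^ 2 ^ l).trace.re ≤ (P ^ 2 ^ l * Q ^ 2 ^ l).trace.re :=
  (re_trace_pow_two_pow_aux l).1 P Q hP hQ

/-- Telescoping. Taking `r ≥ 1` permits `r ^ N` in place of the sharper `r ^ (N - 1)`. -/
lemma norm_pow_sub_pow_le {R : Type*} [NormedRing R] [NormOneClass R] {x y : R} {r : ℝ}
    (hx : ‖x‖ ≤ r) (hy : ‖y‖ ≤ r) (hr : 1 ≤ r) (N : ℕ) :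
    ‖x ^ N - y ^ N‖ ≤ N * r ^ N * ‖x - y‖ := by
  have hr0 : 0 ≤ r := zero_le_one.trans hr
  induction N with
  | zero => simp
  | succ N ih =>
    have e : x ^ (N + 1) - y ^ (N + 1) = x * (x ^ N - y ^ N) + (x - y) * y ^ N := by
      rw [pow_succ', pow_succ']; noncomm_ring
    rw [e]
    calc _ ≤ ‖x‖ * ‖x ^ N - y ^ N‖ + ‖x - y‖ * ‖y ^ N‖ :=
          (norm_add_le _ _).trans (add_le_add (norm_mul_le _ _) (norm_mul_le _ _))
      _ ≤ r * (N * r ^ N * ‖x - y‖) + ‖x - y‖ * r ^ (N + 1) := by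
          gcongr
          exact (norm_pow_le y N).trans <| (pow_le_pow_left₀ (norm_nonneg _) hy N).trans <|
            pow_le_pow_right₀ hr N.le_succ
      _ = _ := by push_cast; ring

lemma norm_exp_le_exp_norm {R : Type*} [NormedRing R] [NormedAlgebra ℚ R]
    [NormOneClass R] [CompleteSpace R] (x : R) : ‖NormedSpace.exp x‖ ≤ Real.exp ‖x‖ := by
  rw [NormedSpace.exp_eq_tsum ℚ, Real.exp_eq_exp_ℝ]
  refine tsum_of_norm_bounded (NormedSpace.expSeries_div_hasSum_exp ‖x‖) fun N => ?_
  refine (norm_smul_le _ _).trans ?_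
  rw [div_eq_inv_mul]
  gcongr
  · rw [norm_inv, ← Rat.norm_cast_real]
    simp
  · exact norm_pow_le x N

/-- The **Lie–Trotter product formula**, in a Banach algebra. -/
theorem tendsto_exp_mul_exp_pow {R : Type*} [NormedRing R] [NormedAlgebra ℝ R]
    [NormOneClass R] [CompleteSpace R] (A B : R) :
    Filter.Tendsto (fun N : ℕ => (NormedSpace.exp ((N : ℝ)⁻¹ • A) *
      NormedSpace.exp ((N : ℝ)⁻¹ • B)) ^ N) Filter.atTop (nhds (NormedSpace.exp (A + B))) := by
  let _ : NormedAlgebra ℚ R := NormedAlgebra.restrictScalars ℚ ℝ R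
  let f : ℝ → R := fun t => NormedSpace.exp (t • A) * NormedSpace.exp (t • B)
  let g : ℝ → R := fun t => NormedSpace.exp (t • (A + B))
  have hf : HasDerivAt f (A + B) 0 := by
    have h := (hasDerivAt_exp_smul_const (𝕂 := ℝ) A (0 : ℝ)).mul
      (hasDerivAt_exp_smul_const (𝕂 := ℝ) B (0 : ℝ))
    simpa [f, Pi.mul_def] using h
  have hg : HasDerivAt g (A + B) 0 := by
    simpa [g] using hasDerivAt_exp_smul_const (𝕂 := ℝ) (A + B) (0 : ℝ)
  -- `f` and `g` agree to first order at `0`, so they differ by `o(1/N)` at `1/N`. Taking `N`-th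
  -- powers amplifies this by at most `N exp (‖A‖ + ‖B‖)`.
  have hfg : HasDerivAt (fun t => f t - g t) 0 0 := by simpa [Pi.sub_def] using hf.sub hg
  have hlim : Filter.Tendsto (fun N : ℕ => (N : ℝ) * ‖f (N : ℝ)⁻¹ - g (N : ℝ)⁻¹‖)
      Filter.atTop (nhds 0) := by
    have h1 := hasDerivAt_iff_tendsto_slope_zero.1 hfg
    have h2 : Filter.Tendsto (fun N : ℕ => (N : ℝ)⁻¹) Filter.atTop (nhdsWithin 0 {0}ᶜ) := by
      refine tendsto_nhdsWithin_iff.2 ⟨tendsto_inv_atTop_nhds_zero_nat, ?_⟩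
      filter_upwards [Filter.eventually_gt_atTop 0] with N hN
      have : (N : ℝ) ≠ 0 := by positivity
      simpa using this
    have h3 := (h1.comp h2).norm
    simpa [f, g, Function.comp_def, norm_smul] using h3
  rw [tendsto_iff_norm_sub_tendsto_zero]
  have hbound : ∀ N : ℕ, 0 < N →
      ‖f (N : ℝ)⁻¹ ^ N - NormedSpace.exp (A + B)‖ ≤
        Real.exp (‖A‖ + ‖B‖) * ((N : ℝ) * ‖f (N : ℝ)⁻¹ - g (N : ℝ)⁻¹‖) := by
    intro N hN
    have hN' : (N : ℝ) ≠ 0 := by positivity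
    have hgN : NormedSpace.exp (A + B) = g (N : ℝ)⁻¹ ^ N := by
      simp only [g]
      rw [← NormedSpace.exp_nsmul, ← Nat.cast_smul_eq_nsmul ℝ, smul_smul, mul_inv_cancel₀ hN',
        one_smul]
    have hfb : ‖f (N : ℝ)⁻¹‖ ≤ Real.exp ((N : ℝ)⁻¹ * (‖A‖ + ‖B‖)) := by
      refine (norm_mul_le _ _).trans ?_
      rw [mul_add, Real.exp_add]
      refine mul_le_mul ?_ ?_ (norm_nonneg _) (Real.exp_nonneg _)
      · refine (norm_exp_le_exp_norm _).trans ?_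
        simp [norm_smul]
      · refine (norm_exp_le_exp_norm _).trans ?_
        simp [norm_smul]
    have hgb : ‖g (N : ℝ)⁻¹‖ ≤ Real.exp ((N : ℝ)⁻¹ * (‖A‖ + ‖B‖)) := by
      refine (norm_exp_le_exp_norm _).trans ?_
      rw [Real.exp_le_exp, norm_smul]
      simp only [norm_inv, Real.norm_natCast]
      gcongr
      exact norm_add_le _ _
    rw [hgN]
    refine (norm_pow_sub_pow_le hfb hgb (Real.one_le_exp (by positivity)) N).trans (le_of_eq ?_)
    rw [← Real.exp_nat_mul, ← mul_assoc (N : ℝ) (N : ℝ)⁻¹, mul_inv_cancel₀ hN', one_mul]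
    ring
  have h0 := hlim.const_mul (Real.exp (‖A‖ + ‖B‖))
  rw [mul_zero] at h0
  refine squeeze_zero' (Filter.Eventually.of_forall fun _ => norm_nonneg _) ?_ h0
  filter_upwards [Filter.eventually_gt_atTop 0] with N hN
  exact hbound N hN

/-- The **Golden–Thompson inequality**. -/
theorem golden_thompson {A B : Matrix n n ℂ} (hA : A.IsHermitian) (hB : B.IsHermitian) :
    (NormedSpace.exp (A + B)).trace.re ≤ (NormedSpace.exp A * NormedSpace.exp B).trace.re := by
  -- The product formula needs `‖1‖ = 1`, which fails for empty matrices.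
  rcases isEmpty_or_nonempty n with hn | hn
  · simp [trace]
  let _ : NormedAlgebra ℚ (Matrix n n ℂ) := NormedAlgebra.restrictScalars ℚ ℝ _
  have hcont : Continuous fun M : Matrix n n ℂ => M.trace.re :=
    Complex.continuous_re.comp (Continuous.matrix_trace continuous_id)
  -- Pass to the subsequence `N = 2 ^ l`, where the trace inequality for powers is available.
  have h1 := (hcont.tendsto _).comp ((tendsto_exp_mul_exp_pow A B).comp
    (tendsto_pow_atTop_atTop_of_one_lt (one_lt_two : (1 : ℕ) < 2)))
  refine le_of_tendsto h1 (Filter.Eventually.of_forall fun l => ?_)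
  simp only [Function.comp_def]
  have hherm : ∀ {M : Matrix n n ℂ}, M.IsHermitian →
      (NormedSpace.exp (((2 ^ l : ℕ) : ℝ)⁻¹ • M)).IsHermitian := fun hM =>
    (isHermitian_real_smul hM _).exp
  refine (re_trace_mul_pow_two_pow_le (hherm hA) (hherm hB) l).trans (le_of_eq ?_)
  have hp : ∀ M : Matrix n n ℂ,
      NormedSpace.exp (((2 ^ l : ℕ) : ℝ)⁻¹ • M) ^ 2 ^ l = NormedSpace.exp M := by
    intro M
    rw [← NormedSpace.exp_nsmul, ← Nat.cast_smul_eq_nsmul ℝ, smul_smul, mul_inv_cancel₀ (by simp),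
      one_smul]
  rw [hp, hp]

end GoldenThompson

/-! ### Matrix Laplace transforms. -/

section Concentration

open Matrix
open scoped Matrix.Norms.L2Operator MatrixOrder ComplexOrder

variable {n : Type} [Fintype n] [DecidableEq n]

/-- `A ↦ Re tr (Q A)` as a continuous real-linear functional. -/
def reTraceMul (Q : Matrix n n ℂ) : Matrix n n ℂ →L[ℝ] ℝ :=
  LinearMap.toContinuousLinearMap
    { toFun := fun A => (Q * A).trace.re
      map_add' := fun A B => by simp [mul_add]
      map_smul' := fun c A => by simp }

lemma reTraceMul_apply (Q A : Matrix n n ℂ) : reTraceMul Q A = (Q * A).trace.re := rfl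

lemma re_trace_mul_nonneg {Q A : Matrix n n ℂ} (hQ : 0 ≤ Q) (hA : 0 ≤ A) :
    0 ≤ (Q * A).trace.re := by
  obtain ⟨B, rfl⟩ := CStarAlgebra.nonneg_iff_eq_star_mul_self.mp hQ
  rw [star_eq_conjTranspose, mul_assoc, trace_mul_comm]
  have := (hA.posSemidef.mul_mul_conjTranspose_same B).trace_nonneg
  exact (Complex.le_def.1 this).1

lemma re_trace_mul_le {Q A B : Matrix n n ℂ} (hQ : 0 ≤ Q) (hAB : A ≤ B) :
    (Q * A).trace.re ≤ (Q * B).trace.re := by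
  have := re_trace_mul_nonneg hQ (sub_nonneg.2 hAB)
  rw [mul_sub, trace_sub, Complex.sub_re] at this
  linarith

lemma exp_le_one_add_add_sq {Y : Matrix n n ℂ} (hY : Y.IsHermitian) (h1 : Y ≤ 1) (h2 : -1 ≤ Y) :
    NormedSpace.exp Y ≤ 1 + Y + Y ^ 2 := by
  have hsa : IsSelfAdjoint Y := hY
  have hs1 : ∀ x ∈ spectrum ℝ Y, x ≤ 1 :=
    (le_algebraMap_iff_spectrum_le (R := ℝ) (r := 1) (a := Y)).1 (by simpa using h1)
  have hs2 : ∀ x ∈ spectrum ℝ Y, -1 ≤ x :=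
    (algebraMap_le_iff_le_spectrum (R := ℝ) (r := -1) (a := Y)).1 (by simpa using h2)
  have e : 1 + Y + Y ^ 2 = cfc (fun x : ℝ => 1 + x + x ^ 2) Y := by
    rw [cfc_add (a := Y) (fun x : ℝ => 1 + x) (fun x => x ^ 2),
      cfc_add (a := Y) (fun _ : ℝ => 1) (fun x => x), cfc_const_one ℝ Y, cfc_id' ℝ Y,
      cfc_pow_id Y 2]
  rw [← CFC.real_exp_eq_normedSpace_exp hsa, e]
  refine cfc_mono fun x hx => ?_
  have := (abs_le.1 (Real.abs_exp_sub_one_sub_id_le (abs_le.2 ⟨hs2 x hx, hs1 x hx⟩))).2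
  linarith

/-- The scalar inequality `x² ≤ K x` on `[0, K]`, through functional calculus. It makes the variance
of order `K` rather than `K²` when the mean is at most `1`. -/
lemma sq_le_smul_of_le {X : Matrix n n ℂ} {K : ℝ} (h0 : 0 ≤ X) (h1 : X ≤ K • (1 : Matrix n n ℂ)) :
    X ^ 2 ≤ K • X := by
  have hsa : IsSelfAdjoint X := IsSelfAdjoint.of_nonneg h0
  have hs1 : ∀ x ∈ spectrum ℝ X, x ≤ K :=
    (le_algebraMap_iff_spectrum_le (R := ℝ) (r := K) (a := X)).1
      (by rwa [Algebra.algebraMap_eq_smul_one])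
  have hs2 : ∀ x ∈ spectrum ℝ X, 0 ≤ x := fun x hx => spectrum_nonneg_of_nonneg h0 hx
  have e : K • X = cfc (fun x : ℝ => K * x) X := by
    rw [cfc_const_mul_id K X]
  rw [e, ← cfc_pow_id (R := ℝ) X 2]
  refine cfc_mono fun x hx => ?_
  nlinarith [hs1 x hx, hs2 x hx]

lemma exp_nonneg_of_isHermitian {A : Matrix n n ℂ} (hA : A.IsHermitian) :
    0 ≤ NormedSpace.exp A :=
  IsSelfAdjoint.exp_nonneg (show IsSelfAdjoint A from hA)

lemma trace_exp_eq_sum {A : Matrix n n ℂ} (hA : A.IsHermitian) :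
    (NormedSpace.exp A).trace.re = ∑ i, Real.exp (hA.eigenvalues i) := by
  rw [← CFC.real_exp_eq_normedSpace_exp (show IsSelfAdjoint A from hA), hA.cfc_eq,
    IsHermitian.cfc, Unitary.conjStarAlgAut_apply, trace_mul_cycle, Unitary.coe_star_mul_self,
    one_mul, trace_diagonal]
  simp [Complex.exp_ofReal_re]

/-- If the quadratic form of `A` exceeds `t` on some vector, then `exp t ≤ tr exp A`. -/
lemma exp_le_trace_exp {A : Matrix n n ℂ} (hA : A.IsHermitian) {t : ℝ} (c : n → ℂ)
    (hc : t * (star c ⬝ᵥ c).re < (star c ⬝ᵥ A *ᵥ c).re) :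
    Real.exp t ≤ (NormedSpace.exp A).trace.re := by
  rw [trace_exp_eq_sum hA]
  obtain ⟨i, hi⟩ : ∃ i, t < hA.eigenvalues i := by
    by_contra! h
    have hle : A ≤ t • (1 : Matrix n n ℂ) := by
      rw [← Algebra.algebraMap_eq_smul_one]
      refine (le_algebraMap_iff_spectrum_le (R := ℝ) (show IsSelfAdjoint A from hA)).2 ?_
      intro x hx
      rw [hA.spectrum_real_eq_range_eigenvalues] at hx
      obtain ⟨i, rfl⟩ := hx
      exact h i
    have := (Complex.le_def.1 ((sub_nonneg.2 hle).posSemidef.dotProduct_mulVec_nonneg c)).1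
    rw [sub_mulVec, dotProduct_sub, smul_mulVec, one_mulVec, dotProduct_smul] at this
    simp at this
    linarith
  exact (Real.exp_le_exp.2 hi.le).trans
    (Finset.single_le_sum (f := fun i => Real.exp (hA.eigenvalues i))
      (fun i _ => (Real.exp_pos _).le) (Finset.mem_univ i))

/-- The **Ahlswede–Winter bound** on the matrix Laplace transform of an i.i.d. sum. -/
theorem lintegral_trace_exp_sum_le (ν : Measure ℕ) [IsProbabilityMeasure ν]
    (Y : ℕ → Matrix n n ℂ) (hY : ∀ j, (Y j).IsHermitian) {R : ℝ} (hR : 0 ≤ R)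
    (H : ∀ Q : Matrix n n ℂ, 0 ≤ Q → ∫⁻ j, ENNReal.ofReal (Q * NormedSpace.exp (Y j)).trace.re ∂ν ≤
      ENNReal.ofReal (R * Q.trace.re)) (m : ℕ) :
    ∫⁻ j, ENNReal.ofReal (NormedSpace.exp (∑ i : Fin m, Y (j i))).trace.re
      ∂(Measure.pi fun _ : Fin m => ν) ≤ ENNReal.ofReal (Fintype.card n * R ^ m) := by
  induction m with
  | zero =>
    simp
  | succ m ih =>
    -- Isolate one sample. Golden–Thompson splits it off, and `H` with `Q` the exponential of the
    -- remaining sum costs a factor `R`. The dimension enters only once, as `tr 1` in the base case.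
    have hmp := (measurePreserving_piFinSuccAbove (fun _ : Fin (m + 1) => ν) 0).symm
    rw [← hmp.lintegral_comp_emb (MeasurableEquiv.measurableEmbedding _)]
    rw [lintegral_prod_symm _ (Measurable.of_discrete.aemeasurable)]
    have hsum : ∀ (a : ℕ) (b : Fin m → ℕ), ∑ i : Fin (m + 1),
        Y ((MeasurableEquiv.piFinSuccAbove (fun _ : Fin (m + 1) => ℕ) 0).symm (a, b) i) =
        (∑ i, Y (b i)) + Y a := by
      intro a b
      rw [Fin.sum_univ_succ, add_comm]
      simp [MeasurableEquiv.piFinSuccAbove, Fin.insertNthEquiv]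
    simp only [hsum]
    calc _ ≤ ∫⁻ b : Fin m → ℕ, ENNReal.ofReal
          (R * (NormedSpace.exp (∑ i : Fin m, Y (b i))).trace.re)
          ∂(Measure.pi fun _ : Fin m => ν) := by
          refine lintegral_mono fun b => ?_
          have hS : (∑ i : Fin m, Y (b i)).IsHermitian := by
            rw [IsHermitian, conjTranspose_sum]
            exact Finset.sum_congr rfl fun i _ => (hY _).eq
          refine (lintegral_mono fun a => ENNReal.ofReal_le_ofReal
            (golden_thompson hS (hY a))).trans ?_
          exact H _ (exp_nonneg_of_isHermitian hS)
      _ = ENNReal.ofReal R * ∫⁻ b : Fin m → ℕ, ENNReal.ofReal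
          ((NormedSpace.exp (∑ i : Fin m, Y (b i))).trace.re)
          ∂(Measure.pi fun _ : Fin m => ν) := by
          simp only [ENNReal.ofReal_mul hR]
          rw [lintegral_const_mul' _ _ ENNReal.ofReal_ne_top]
      _ ≤ ENNReal.ofReal R * ENNReal.ofReal (Fintype.card n * R ^ m) := by gcongr
      _ = _ := by
          rw [← ENNReal.ofReal_mul hR, pow_succ]
          ring_nf

end Concentration

/-! ### Matrix Chernoff bound. -/

section Deviation

open Matrix
open scoped Matrix.Norms.L2Operator MatrixOrder ComplexOrder

variable {n : Type} [Fintype n] [DecidableEq n] {ν : Measure ℕ} [IsProbabilityMeasure ν]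
  {X : ℕ → Matrix n n ℂ} {K : ℝ}

omit [IsProbabilityMeasure ν] in
lemma integrable_of_nonneg_of_le [IsFiniteMeasure ν] (hX0 : ∀ j, 0 ≤ X j)
    (hXK : ∀ j, X j ≤ K • (1 : Matrix n n ℂ)) :
    Integrable X ν :=
  Integrable.of_bound StronglyMeasurable.of_discrete.aestronglyMeasurable
    ‖K • (1 : Matrix n n ℂ)‖
    (Filter.Eventually.of_forall fun j => CStarAlgebra.norm_le_norm_of_nonneg_of_le (hX0 j) (hXK j))

/-- Use `exp Y ≤ 1 + Y + Y²` for `-1 ≤ Y ≤ 1`, then `X² ≤ K X` inside the square. The resulting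
bound is affine in `X`, so only the mean of `X` is needed to integrate it. -/
lemma re_trace_mul_exp_le {Q X M : Matrix n n ℂ} (hQ : 0 ≤ Q) (hK : 1 ≤ K) (hX0 : 0 ≤ X)
    (hXK : X ≤ K • (1 : Matrix n n ℂ)) (hM0 : 0 ≤ M) (hM1 : M ≤ 1) {θ : ℝ} (hθ : |θ| * K ≤ 1) :
    (Q * NormedSpace.exp (θ • (X - M))).trace.re ≤
      Q.trace.re + θ * (reTraceMul Q X - reTraceMul Q M) +
        θ ^ 2 * (K * reTraceMul Q X - reTraceMul (M * Q) X - reTraceMul (Q * M) X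
          + reTraceMul Q (M ^ 2)) := by
  have hK0 : 0 ≤ K := zero_le_one.trans hK
  have hXh : X.IsHermitian := hX0.posSemidef.isHermitian
  have hMh : M.IsHermitian := hM0.posSemidef.isHermitian
  have h1K : (1 : Matrix n n ℂ) ≤ K • 1 := by
    simpa using smul_le_smul_of_nonneg_right hK (zero_le_one : (0 : Matrix n n ℂ) ≤ 1)
  have hup : X - M ≤ K • (1 : Matrix n n ℂ) := (sub_le_self X hM0).trans hXK
  have hlow : -(K • (1 : Matrix n n ℂ)) ≤ X - M := by
    rw [neg_le, neg_sub]
    exact (sub_le_self M hX0).trans (hM1.trans h1K)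
  have habs : |θ| • (K • (1 : Matrix n n ℂ)) ≤ 1 := by
    rw [smul_smul]
    simpa using smul_le_smul_of_nonneg_right hθ (zero_le_one : (0 : Matrix n n ℂ) ≤ 1)
  have hY : (θ • (X - M)).IsHermitian := isHermitian_real_smul (hXh.sub hMh) θ
  have hb : θ • (X - M) ≤ 1 ∧ -1 ≤ θ • (X - M) := by
    have hu := (smul_le_smul_of_nonneg_left hup (abs_nonneg θ)).trans habs
    have hl := smul_le_smul_of_nonneg_left hlow (abs_nonneg θ)
    rw [smul_neg] at hl
    have hl' := (neg_le_neg habs).trans hl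
    rcases abs_choice θ with h | h
    · rw [h] at hu hl'
      exact ⟨hu, hl'⟩
    · rw [h, neg_smul] at hu hl'
      exact ⟨neg_le_neg_iff.1 hl', neg_le.1 hu⟩
  refine (re_trace_mul_le hQ (exp_le_one_add_add_sq hY hb.1 hb.2)).trans ?_
  have hsq : (X - M) ^ 2 ≤ K • X - X * M - M * X + M ^ 2 := by
    have e : (X - M) ^ 2 = X ^ 2 - X * M - M * X + M ^ 2 := by noncomm_ring
    rw [e]
    gcongr
    exact sq_le_smul_of_le hX0 hXK
  have h2 := re_trace_mul_le hQ hsq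
  have e2 : (Q * (K • X - X * M - M * X + M ^ 2)).trace.re =
      K * reTraceMul Q X - reTraceMul (M * Q) X - reTraceMul (Q * M) X + reTraceMul Q (M ^ 2) := by
    simp only [reTraceMul_apply, mul_add, mul_sub, trace_add, trace_sub, Complex.add_re,
      Complex.sub_re, mul_smul_comm, trace_smul, Complex.real_smul, Complex.re_ofReal_mul]
    rw [← mul_assoc Q X M, trace_mul_cycle Q X M, ← mul_assoc Q M X]
  rw [e2] at h2
  have e3 : (Q * (1 + θ • (X - M) + (θ • (X - M)) ^ 2)).trace.re =
      Q.trace.re + θ * (reTraceMul Q X - reTraceMul Q M) +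
        θ ^ 2 * (Q * (X - M) ^ 2).trace.re := by
    rw [smul_pow]
    simp only [reTraceMul_apply, mul_add, mul_sub, trace_add, trace_sub, Complex.add_re,
      Complex.sub_re, mul_smul_comm, trace_smul, Complex.real_smul, Complex.re_ofReal_mul, mul_one]
  rw [e3]
  gcongr

lemma lintegral_trace_mul_exp_le (hK : 1 ≤ K) (hX0 : ∀ j, 0 ≤ X j)
    (hXK : ∀ j, X j ≤ K • (1 : Matrix n n ℂ)) (hM1 : ∫ j, X j ∂ν ≤ 1) {θ : ℝ}
    (hθ : |θ| * K ≤ 1) {Q : Matrix n n ℂ} (hQ : 0 ≤ Q) :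
    ∫⁻ j, ENNReal.ofReal (Q * NormedSpace.exp (θ • (X j - ∫ j, X j ∂ν))).trace.re ∂ν ≤
      ENNReal.ofReal (Real.exp (θ ^ 2 * K) * Q.trace.re) := by
  have hint := integrable_of_nonneg_of_le (ν := ν) hX0 hXK
  have hM0 : 0 ≤ ∫ j, X j ∂ν := integral_nonneg hX0
  set M := ∫ j, X j ∂ν with hMdef
  let g : ℕ → ℝ := fun j => Q.trace.re + θ * (reTraceMul Q (X j) - reTraceMul Q M) +
        θ ^ 2 * (K * reTraceMul Q (X j) - reTraceMul (M * Q) (X j) - reTraceMul (Q * M) (X j)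
          + reTraceMul Q (M ^ 2))
  have hfg : ∀ j, (Q * NormedSpace.exp (θ • (X j - M))).trace.re ≤ g j := fun j =>
    re_trace_mul_exp_le hQ hK (hX0 j) (hXK j) hM0 hM1 hθ
  have hf0 : ∀ j, 0 ≤ (Q * NormedSpace.exp (θ • (X j - M))).trace.re := fun j =>
    re_trace_mul_nonneg hQ (exp_nonneg_of_isHermitian (isHermitian_real_smul
      ((hX0 j).posSemidef.isHermitian.sub hM0.posSemidef.isHermitian) θ))
  let L : Matrix n n ℂ →L[ℝ] ℝ := θ • reTraceMul Q +
    θ ^ 2 • (K • reTraceMul Q - reTraceMul (M * Q) - reTraceMul (Q * M))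
  let C : ℝ := Q.trace.re - θ * reTraceMul Q M + θ ^ 2 * reTraceMul Q (M ^ 2)
  have hgL : g = fun j => L (X j) + C := by
    funext j
    simp only [g, L, C, _root_.add_apply, _root_.sub_apply, _root_.smul_apply, smul_eq_mul]
    ring
  have hgi : Integrable g ν := hgL ▸ (L.integrable_comp hint).add (integrable_const C)
  -- The term linear in `θ` averages to zero. The two cross terms give `-2 tr (Q M²)`, of which one
  -- half cancels against `+ tr (Q M²)`.
  have hgint : ∫ j, g j ∂ν = Q.trace.re + θ ^ 2 * (K * reTraceMul Q M - reTraceMul Q (M ^ 2)) := by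
    have e1 : ∫ j, g j ∂ν = L M + C := by
      rw [hgL, integral_add (L.integrable_comp hint) (integrable_const C),
        L.integral_comp_comm hint]
      simp [hMdef]
    rw [e1]
    have e2 : reTraceMul (M * Q) M = reTraceMul Q (M ^ 2) := by
      rw [reTraceMul_apply, reTraceMul_apply, trace_mul_cycle, pow_two, trace_mul_comm]
    have e3 : reTraceMul (Q * M) M = reTraceMul Q (M ^ 2) := by
      rw [reTraceMul_apply, reTraceMul_apply, pow_two, mul_assoc]
    simp only [L, C, _root_.add_apply, _root_.sub_apply, _root_.smul_apply, smul_eq_mul]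
    rw [e2, e3]
    ring
  calc _ ≤ ∫⁻ j, ENNReal.ofReal (g j) ∂ν :=
        lintegral_mono fun j => ENNReal.ofReal_le_ofReal (hfg j)
    _ = ENNReal.ofReal (∫ j, g j ∂ν) := (ofReal_integral_eq_lintegral_ofReal hgi
        (Filter.Eventually.of_forall fun j => (hf0 j).trans (hfg j))).symm
    _ ≤ _ := by
      refine ENNReal.ofReal_le_ofReal ?_
      rw [hgint]
      have hM2 : 0 ≤ reTraceMul Q (M ^ 2) :=
        re_trace_mul_nonneg hQ (hM0.posSemidef.pow 2).nonneg
      have hMQ : reTraceMul Q M ≤ Q.trace.re := by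
        simpa [reTraceMul_apply] using re_trace_mul_le hQ hM1
      have hQ0 : 0 ≤ Q.trace.re := by
        simpa using re_trace_mul_nonneg hQ (zero_le_one : (0 : Matrix n n ℂ) ≤ 1)
      have hK0 : 0 ≤ K := zero_le_one.trans hK
      calc _ ≤ Q.trace.re + θ ^ 2 * (K * Q.trace.re) := by
            gcongr
            nlinarith
        _ = (θ ^ 2 * K + 1) * Q.trace.re := by ring
        _ ≤ _ := by
          gcongr
          exact Real.add_one_le_exp _

/-- Markov's inequality for `tr exp`, which is at least `exp t` as soon as some vector witnesses an
eigenvalue above `t`; no net of vectors is needed. -/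
lemma measure_quadraticForm_gt_le (hK : 1 ≤ K) (hX0 : ∀ j, 0 ≤ X j)
    (hXK : ∀ j, X j ≤ K • (1 : Matrix n n ℂ)) (hM1 : ∫ j, X j ∂ν ≤ 1) {θ : ℝ}
    (hθ : |θ| * K ≤ 1) (t : ℝ) (m : ℕ) :
    (Measure.pi fun _ : Fin m => ν) {j | ∃ c : n → ℂ, t * (star c ⬝ᵥ c).re <
        (star c ⬝ᵥ (∑ i, θ • (X (j i) - ∫ j, X j ∂ν)) *ᵥ c).re} ≤
      ENNReal.ofReal (Fintype.card n * Real.exp (m * (θ ^ 2 * K) - t)) := by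
  set M := ∫ j, X j ∂ν with hMdef
  have hM0 : 0 ≤ M := integral_nonneg hX0
  have hY : ∀ j, (θ • (X j - M)).IsHermitian := fun j => isHermitian_real_smul
      ((hX0 j).posSemidef.isHermitian.sub hM0.posSemidef.isHermitian) θ
  have hAW := lintegral_trace_exp_sum_le ν (fun j => θ • (X j - M)) hY (Real.exp_nonneg (θ ^ 2 * K))
    (fun Q hQ => lintegral_trace_mul_exp_le hK hX0 hXK hM1 hθ hQ) m
  have hsub : {j : Fin m → ℕ | ∃ c : n → ℂ, t * (star c ⬝ᵥ c).re <
        (star c ⬝ᵥ (∑ i, θ • (X (j i) - M)) *ᵥ c).re} ⊆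
      {j | ENNReal.ofReal (Real.exp t) ≤
        ENNReal.ofReal (NormedSpace.exp (∑ i : Fin m, θ • (X (j i) - M))).trace.re} := by
    rintro j ⟨c, hc⟩
    refine ENNReal.ofReal_le_ofReal (exp_le_trace_exp ?_ c hc)
    rw [IsHermitian, conjTranspose_sum]
    exact Finset.sum_congr rfl fun i _ => (hY _).eq
  refine (measure_mono hsub).trans ?_
  refine (meas_ge_le_lintegral_div Measurable.of_discrete.aemeasurable
    (by simpa using Real.exp_pos t) ENNReal.ofReal_ne_top).trans ?_
  refine (ENNReal.div_le_div_right hAW _).trans (le_of_eq ?_)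
  rw [← ENNReal.ofReal_div_of_pos (Real.exp_pos t), ← Real.exp_nat_mul, mul_div_assoc,
    ← Real.exp_sub]

/-- **Matrix Chernoff inequality**, additive and two-sided, for i.i.d. positive semidefinite matrices
`0 ≤ X ≤ K` with mean at most `1`. -/
theorem measure_deviation_gt_le (hK : 1 ≤ K) (hX0 : ∀ j, 0 ≤ X j)
    (hXK : ∀ j, X j ≤ K • (1 : Matrix n n ℂ)) (hM1 : ∫ j, X j ∂ν ≤ 1) {δ : ℝ} (hδ0 : 0 < δ)
    (hδ1 : δ < 1) (m : ℕ) :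
    (Measure.pi fun _ : Fin m => ν) {j | ∃ c : n → ℂ, m * δ * (star c ⬝ᵥ c).re <
        |(star c ⬝ᵥ (∑ i, (X (j i) - ∫ j, X j ∂ν)) *ᵥ c).re|} ≤
      ENNReal.ofReal (2 * Fintype.card n * Real.exp (-(m * δ ^ 2 / (4 * K)))) := by
  have hK0 : 0 < K := zero_lt_one.trans_le hK
  set M := ∫ j, X j ∂ν
  -- Minimises `m θ² K - θ m δ`, with value `-m δ² / (4 K)`; this is the `4` of the sample bound.
  -- The lower tail uses `-θ`.
  set θ : ℝ := δ / (2 * K) with hθ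
  have hθ0 : 0 < θ := by positivity
  have hθK : θ * K = δ / 2 := by rw [hθ]; field_simp
  have hθ1 : |θ| * K ≤ 1 := by rw [abs_of_pos hθ0, hθK]; linarith
  have hθ2 : |-θ| * K ≤ 1 := by rwa [abs_neg]
  have b1 := measure_quadraticForm_gt_le hK hX0 hXK hM1 hθ1 (θ * (m * δ)) m
  have b2 := measure_quadraticForm_gt_le hK hX0 hXK hM1 hθ2 (θ * (m * δ)) m
  have hexp : (m : ℝ) * (θ ^ 2 * K) - θ * (m * δ) = -(m * δ ^ 2 / (4 * K)) := by
    rw [hθ]; field_simp; ring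
  rw [neg_sq, hexp] at b2
  rw [hexp] at b1
  have hsub : {j : Fin m → ℕ | ∃ c : n → ℂ, m * δ * (star c ⬝ᵥ c).re <
        |(star c ⬝ᵥ (∑ i, (X (j i) - M)) *ᵥ c).re|} ⊆
      {j | ∃ c : n → ℂ, θ * (m * δ) * (star c ⬝ᵥ c).re <
        (star c ⬝ᵥ (∑ i, θ • (X (j i) - M)) *ᵥ c).re} ∪
      {j | ∃ c : n → ℂ, θ * (m * δ) * (star c ⬝ᵥ c).re <
        (star c ⬝ᵥ (∑ i, (-θ) • (X (j i) - M)) *ᵥ c).re} := by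
    rintro j ⟨c, hc⟩
    have hlin : ∀ s : ℝ, (star c ⬝ᵥ (∑ i, s • (X (j i) - M)) *ᵥ c).re =
        s * (star c ⬝ᵥ (∑ i, (X (j i) - M)) *ᵥ c).re := by
      intro s
      rw [← Finset.smul_sum, smul_mulVec, dotProduct_smul, Complex.real_smul, Complex.re_ofReal_mul]
    rcases lt_abs.1 hc with h | h
    · refine Or.inl ⟨c, ?_⟩
      rw [hlin, mul_assoc]
      exact mul_lt_mul_of_pos_left h hθ0
    · refine Or.inr ⟨c, ?_⟩
      rw [hlin, neg_mul, ← mul_neg, mul_assoc]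
      exact mul_lt_mul_of_pos_left h hθ0
  refine (measure_mono hsub).trans ((measure_union_le _ _).trans ((add_le_add b1 b2).trans ?_))
  rw [← ENNReal.ofReal_add (by positivity) (by positivity)]
  apply le_of_eq
  congr 1
  ring

end Deviation

/-! ### Counting sign patterns. -/

section Counting

/-- The sets of indices on which the linear functionals `f l` can be simultaneously positive (and
nonpositive on the complement). -/
def signPatterns {ι E : Type*} [Fintype ι] [AddCommGroup E] [Module ℝ E]
    (f : ι → E →ₗ[ℝ] ℝ) : Finset (Finset ι) :=
  open Classical in Finset.univ.filter fun s => ∃ z, ∀ l, l ∈ s ↔ 0 < f l z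

lemma mem_signPatterns {ι E : Type*} [Fintype ι] [AddCommGroup E] [Module ℝ E]
    {f : ι → E →ₗ[ℝ] ℝ} {s : Finset ι} : s ∈ signPatterns f ↔ ∃ z, ∀ l, l ∈ s ↔ 0 < f l z := by
  simp [signPatterns]

/-- More than `dim E` functionals satisfy a relation `∑ g l • f l = 0`. Shattering provides a `z`
with `f l z` positive exactly where `g l` is, and then `∑ g l * f l z > 0`. -/
lemma vcDim_signPatterns_le {ι E : Type*} [Fintype ι] [DecidableEq ι] [AddCommGroup E] [Module ℝ E]
    [FiniteDimensional ℝ E] (f : ι → E →ₗ[ℝ] ℝ) :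
    (signPatterns f).vcDim ≤ Module.finrank ℝ E := by
  refine Finset.sup_le fun S hS => ?_
  rw [Finset.mem_shatterer] at hS
  by_contra! hlt
  have hdep : ¬ LinearIndependent ℝ (fun l : S => f l) := by
    intro h
    have := h.fintype_card_le_finrank
    rw [Fintype.card_coe, Subspace.dual_finrank_eq] at this
    omega
  -- Some coefficient must be positive: indices with `g l ≤ 0` contribute only nonnegative terms,
  -- possibly zero.
  obtain ⟨g, hg0, l₀, hl₀⟩ : ∃ g : S → ℝ, ∑ l, g l • f l = 0 ∧ ∃ l, 0 < g l := by
    obtain ⟨g, hg0, l, hl⟩ := Fintype.not_linearIndependent_iff.1 hdep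
    rcases lt_or_gt_of_ne hl with h | h
    · have hneg : ∑ l, (-g) l • f l = 0 := by
        ext z
        have := congrArg (fun φ : E →ₗ[ℝ] ℝ => φ z) hg0
        simp only [LinearMap.sum_apply, LinearMap.smul_apply, LinearMap.zero_apply, smul_eq_mul,
          Pi.neg_apply, neg_mul, Finset.sum_neg_distrib] at this ⊢
        rw [this, neg_zero]
      exact ⟨-g, hneg, l, by simpa using h⟩
    · exact ⟨g, hg0, l, h⟩
  let T : Finset ι := (Finset.univ.filter fun l : S => 0 < g l).map (Function.Embedding.subtype _)
  have hT : T ⊆ S := by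
    intro l hl
    simp only [T, Finset.mem_map, Finset.mem_filter] at hl
    obtain ⟨x, -, rfl⟩ := hl
    exact x.2
  obtain ⟨u, hu, hSu⟩ := hS hT
  obtain ⟨z, hz⟩ := mem_signPatterns.1 hu
  have hiff : ∀ l : S, 0 < f l z ↔ 0 < g l := by
    intro l
    rw [← hz]
    have h1 : (l : ι) ∈ S ∩ u ↔ (l : ι) ∈ u := by simp
    rw [← h1, hSu]
    simp [T]
  have hsum : ∑ l, g l * f l z = 0 := by
    simpa using congrArg (fun φ : E →ₗ[ℝ] ℝ => φ z) hg0
  have hpos : 0 < ∑ l, g l * f l z := by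
    refine Finset.sum_pos' (fun l _ => ?_) ⟨l₀, Finset.mem_univ _, mul_pos hl₀ ((hiff l₀).2 hl₀)⟩
    by_cases h : 0 < g l
    · exact (mul_pos h ((hiff l).2 h)).le
    · exact mul_nonneg_of_nonpos_of_nonpos (not_lt.1 h) (not_lt.1 ((hiff l).not.2 h))
  exact hpos.ne' hsum

lemma card_signPatterns_le {ι E : Type*} [Fintype ι] [AddCommGroup E] [Module ℝ E]
    [FiniteDimensional ℝ E] (f : ι → E →ₗ[ℝ] ℝ) :
    (signPatterns f).card ≤
      ∑ i ∈ Finset.range (Module.finrank ℝ E + 1), (Fintype.card ι).choose i := by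
  classical
  refine (Finset.card_le_card_shatterer _).trans (Finset.card_shatterer_le_sum_vcDim.trans ?_)
  refine Finset.sum_le_sum_of_subset fun i hi => ?_
  have := vcDim_signPatterns_le f
  simp only [Finset.mem_Iic, Finset.mem_range] at hi ⊢
  omega

/-- Weight by `x = k / N ≤ 1`: since `x ^ k ≤ x ^ i` for `i ≤ k`, the weighted sum is at most `(1 +
x) ^ N ≤ exp k`. -/
lemma sum_choose_le_pow {k N : ℕ} (hk : 0 < k) (hkN : k ≤ N) :
    ((∑ i ∈ Finset.range (k + 1), N.choose i : ℕ) : ℝ) ≤ (Real.exp 1 * N / k) ^ k := by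
  have hk' : (0 : ℝ) < k := by exact_mod_cast hk
  have hN' : (0 : ℝ) < N := by exact_mod_cast hk.trans_le hkN
  set x : ℝ := k / N with hx
  have hx0 : 0 < x := by positivity
  have hx1 : x ≤ 1 := (div_le_one hN').2 (by exact_mod_cast hkN)
  have h1 : x ^ k * ((∑ i ∈ Finset.range (k + 1), N.choose i : ℕ) : ℝ) ≤ Real.exp 1 ^ k := by
    push_cast
    rw [Finset.mul_sum]
    calc _ ≤ ∑ i ∈ Finset.range (k + 1), x ^ i * (N.choose i : ℝ) := by
          refine Finset.sum_le_sum fun i hi => ?_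
          have hi' : i ≤ k := by simpa [Nat.lt_succ_iff] using hi
          exact mul_le_mul_of_nonneg_right (pow_le_pow_of_le_one hx0.le hx1 hi') (Nat.cast_nonneg _)
      _ ≤ ∑ i ∈ Finset.range (N + 1), x ^ i * (N.choose i : ℝ) :=
          Finset.sum_le_sum_of_subset_of_nonneg
            (Finset.range_subset_range.2 (by omega)) fun i _ _ => by positivity
      _ = (x + 1) ^ N := by simp [add_pow]
      _ ≤ Real.exp x ^ N := by gcongr; exact Real.add_one_le_exp x
      _ = Real.exp 1 ^ k := by
          rw [← Real.exp_nat_mul, ← Real.exp_nat_mul, hx, mul_one, mul_div_cancel₀ _ hN'.ne']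
  have e : Real.exp 1 * N / k = Real.exp 1 / x := by rw [hx]; field_simp
  rw [e, div_pow, le_div_iff₀ (by positivity), mul_comm]
  exact h1

end Counting

/-! ### Piecewise linearity of the network. -/

section Pieces

variable {k d : ℕ}

/-- The convex cone on which exactly the functionals `f l`, `l ∈ s`, are positive. -/
def signCone {ι E : Type*} [AddCommGroup E] [Module ℝ E] (f : ι → E →ₗ[ℝ] ℝ) (s : Finset ι) :
    ConvexCone ℝ E where
  carrier := {z | ∀ l, l ∈ s ↔ 0 < f l z}
  smul_mem' c hc z hz l := by
    rw [hz l, map_smul, smul_eq_mul, mul_pos_iff_of_pos_left hc]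
  add_mem' y hy z hz l := by
    rw [map_add]
    by_cases h : l ∈ s
    · simp [h, add_pos ((hy l).1 h) ((hz l).1 h)]
    · have h1 := (hy l).not.1 h
      have h2 := (hz l).not.1 h
      simp only [h, false_iff]
      linarith

/-- The real functionals `z ↦ Re (A z)ₗ` and `z ↦ Im (A z)ₗ`. -/
def reImFunctional {E : Type*} [AddCommGroup E] [Module ℝ E] {w : ℕ} (A : E →ₗ[ℝ] (Fin w → ℂ))
    (l : Fin w × Bool) : E →ₗ[ℝ] ℝ :=
  (if l.2 then Complex.imLm else Complex.reLm) ∘ₗ LinearMap.proj l.1 ∘ₗ A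

/-- The linear map that agrees with `relu ∘ A` on the cone of sign pattern `s`. -/
def reluLinear {E : Type*} [AddCommGroup E] [Module ℝ E] {w : ℕ} (A : E →ₗ[ℝ] (Fin w → ℂ))
    (s : Finset (Fin w × Bool)) : E →ₗ[ℝ] (Fin w → ℂ) where
  toFun z l := ⟨if (l, false) ∈ s then (A z l).re else 0, if (l, true) ∈ s then (A z l).im else 0⟩
  map_add' y z := by
    funext l
    apply Complex.ext <;> simp only [map_add, Pi.add_apply, Complex.add_re, Complex.add_im] <;>
      split_ifs <;> simp
  map_smul' c z := by
    funext l
    apply Complex.ext <;> simp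

lemma relu_eq_reluLinear {E : Type*} [AddCommGroup E] [Module ℝ E] {w : ℕ}
    (A : E →ₗ[ℝ] (Fin w → ℂ)) {s : Finset (Fin w × Bool)} {z : E}
    (hz : z ∈ signCone (reImFunctional A) s) (l : Fin w) : relu (A z l) = reluLinear A s z l := by
  have h0 : (l, false) ∈ s ↔ 0 < (A z l).re := hz (l, false)
  have h1 : (l, true) ∈ s ↔ 0 < (A z l).im := hz (l, true)
  apply Complex.ext
  · simp only [relu, reluLinear, LinearMap.coe_mk, AddHom.coe_mk, h0]
    split_ifs with h
    · exact max_eq_right h.le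
    · exact max_eq_left (not_lt.1 h)
  · simp only [relu, reluLinear, LinearMap.coe_mk, AddHom.coe_mk, h1]
    split_ifs with h
    · exact max_eq_right h.le
    · exact max_eq_left (not_lt.1 h)

lemma GenerativeNetwork.width_le_of_le (G : GenerativeNetwork k d) {i j : ℕ} (hij : i ≤ j)
    (hj : j ≤ d) : G.width i ≤ G.width j := by
  induction j, hij using Nat.le_induction with
  | base => exact le_rfl
  | succ j _ ih => exact (ih (by omega)).trans (G.width_mono j (by omega))

/-- After `i` layers, the latent space splits into at most `(2 e k_d / k)^(k i)` convex cones on each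
of which the network is linear. -/
theorem GenerativeNetwork.exists_linear_pieces (G : GenerativeNetwork k d) (i : ℕ) (hi : i ≤ d) :
    ∃ (ι : Type) (_ : Fintype ι) (C : ι → ConvexCone ℝ (Fin (G.width 0) → ℝ))
      (L : ι → (Fin (G.width 0) → ℝ) →ₗ[ℝ] (Fin (G.width i) → ℂ)),
      (∀ z, ∃ a, z ∈ C a) ∧ (∀ a, ∀ z ∈ C a, G.hidden z i = L a z) ∧
      (Fintype.card ι : ℝ) ≤ ((2 * Real.exp 1 * G.width d / k) ^ k) ^ i := by
  induction i with
  | zero =>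
    refine ⟨Unit, inferInstance, fun _ => ⊤,
      fun _ => (Complex.ofRealCLM : ℝ →ₗ[ℝ] ℂ).compLeft _, fun z => ⟨(), by simp⟩, ?_, by simp⟩
    intro a z _
    rfl
  | succ i ih =>
    obtain ⟨ι, _, C, L, hcov, hlin, hcard⟩ := ih (by omega)
    let A : ι → (Fin (G.width 0) → ℝ) →ₗ[ℝ] (Fin (G.width (i + 1)) → ℂ) := fun a =>
      ((G.weight i).mulVecLin.restrictScalars ℝ) ∘ₗ L a
    refine ⟨Σ a, {s // s ∈ signPatterns (reImFunctional (A a))}, inferInstance,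
      fun x => C x.1 ⊓ signCone (reImFunctional (A x.1)) x.2.1,
      fun x => reluLinear (A x.1) x.2.1, ?_, ?_, ?_⟩
    · intro z
      obtain ⟨a, ha⟩ := hcov z
      classical
      let s : Finset (Fin (G.width (i + 1)) × Bool) :=
        Finset.univ.filter fun l => 0 < reImFunctional (A a) l z
      have hs : ∀ l, l ∈ s ↔ 0 < reImFunctional (A a) l z := by simp [s]
      exact ⟨⟨a, s, mem_signPatterns.2 ⟨z, hs⟩⟩, ha, hs⟩
    · rintro ⟨a, s, hs⟩ z ⟨hz1, hz2⟩
      funext l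
      rw [← relu_eq_reluLinear (A a) hz2 l]
      simp only [GenerativeNetwork.hidden, hlin a z hz1]
      rfl
    · have hk : 0 < k := by have := G.two_le; omega
      have hw1 : k ≤ G.width (i + 1) := by
        have := G.width_le_of_le (Nat.zero_le (i + 1)) hi
        rwa [G.width_zero] at this
      have hw2 := G.width_le_of_le hi le_rfl
      -- Real and imaginary parts give two functionals per neuron, hence the `2` in `2 e k_d / k`.
      -- Patterns are counted on the whole latent space, so some refined cones may be empty.
      have hone : ∀ a, ((signPatterns (reImFunctional (A a))).card : ℝ) ≤
          (2 * Real.exp 1 * G.width d / k) ^ k := by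
        intro a
        have h1 := card_signPatterns_le (reImFunctional (A a))
        have hfr : Module.finrank ℝ (Fin (G.width 0) → ℝ) = k := by
          rw [Module.finrank_fin_fun, G.width_zero]
        rw [hfr, Fintype.card_prod, Fintype.card_fin,
          Fintype.card_bool] at h1
        refine (Nat.cast_le.2 h1).trans ((sum_choose_le_pow hk (by omega)).trans ?_)
        have hw2' : (G.width (i + 1) : ℝ) ≤ G.width d := by exact_mod_cast hw2
        refine pow_le_pow_left₀ (by positivity) (div_le_div_of_nonneg_right ?_ (by positivity)) k
        push_cast
        nlinarith [Real.exp_pos 1]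
      rw [Fintype.card_sigma, Nat.cast_sum]
      calc _ ≤ ∑ _a : ι, (2 * Real.exp 1 * G.width d / k) ^ k := by
            refine Finset.sum_le_sum fun a _ => ?_
            rw [Fintype.card_coe]
            exact hone a
        _ = Fintype.card ι * (2 * Real.exp 1 * G.width d / k) ^ k := by simp
        _ ≤ _ := by
            rw [pow_succ]
            gcongr

end Pieces

/-! ### Isometry on a fixed subspace. -/

section Subspace

open Matrix
open scoped Matrix.Norms.L2Operator MatrixOrder ComplexOrder

lemma hasSum_sq_norm (x : Ell2) : HasSum (fun j => ‖x j‖ ^ 2) (‖x‖ ^ 2) := by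
  have h := lp.hasSum_norm (p := 2) (by simp) x
  simpa using h

lemma norm_supportProj_le (p : PMF ℕ) (x : Ell2) : ‖supportProj p x‖ ≤ ‖x‖ := by
  refine le_of_sq_le_sq ?_ (norm_nonneg x)
  refine hasSum_le (fun j => ?_) (hasSum_sq_norm _) (hasSum_sq_norm x)
  change ‖if 0 < p j then x j else 0‖ ^ 2 ≤ ‖x j‖ ^ 2
  split_ifs
  · exact le_rfl
  · simp

/-- The energy `|y_j|² / p_j` of the weighted sequence `D y` at `j`. -/
lemma sq_norm_weightOp (p : PMF ℕ) (y : ℕ → ℂ) (j : ℕ) :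
    ‖weightOp p y j‖ ^ 2 = ‖y j‖ ^ 2 / (p j).toReal := by
  change ‖if 0 < p j then y j / (Real.sqrt (p j).toReal : ℂ) else 0‖ ^ 2 = _
  split_ifs with h
  · rw [norm_div, div_pow, Complex.norm_real, Real.norm_eq_abs, sq_abs,
      Real.sq_sqrt ENNReal.toReal_nonneg]
  -- Here the right-hand side divides by zero and returns `0`, in agreement with `D`.
  · have : p j = 0 := by simpa using h
    simp [this]

lemma sq_norm_samplingOp {m : ℕ} (J : Fin m → ℕ) (y : ℕ → ℂ) :
    ‖samplingOp J y‖ ^ 2 = ∑ i, ‖y (J i)‖ ^ 2 := by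
  rw [EuclideanSpace.norm_sq_eq]
  rfl

lemma sq_norm_supportProj (p : PMF ℕ) (x : Ell2) :
    ‖supportProj p x‖ ^ 2 = ∑' j, (p j).toReal * ‖weightOp p x j‖ ^ 2 := by
  rw [← (hasSum_sq_norm (supportProj p x)).tsum_eq]
  refine tsum_congr fun j => ?_
  rw [sq_norm_weightOp]
  change ‖if 0 < p j then x j else 0‖ ^ 2 = _
  split_ifs with h
  · have := ENNReal.toReal_pos h.ne' (p.apply_ne_top j)
    field_simp
  · have : p j = 0 := by simpa using h
    simp [this]

variable {N : ℕ}

/-- The rank-one matrix of the quadratic form `c ↦ |(D F ∑ cₐ bₐ)_j|²`. -/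
def sampleMatrix (F : Ell2 ≃ₗᵢ[ℂ] Ell2) (p : PMF ℕ) (b : Fin N → Ell2) (j : ℕ) :
    Matrix (Fin N) (Fin N) ℂ :=
  vecMulVec (star fun a => weightOp p (F (b a)) j) (fun a => weightOp p (F (b a)) j)

lemma weightOp_sum (F : Ell2 ≃ₗᵢ[ℂ] Ell2) (p : PMF ℕ) (b : Fin N → Ell2) (c : Fin N → ℂ) (j : ℕ) :
    weightOp p (F (∑ a, c a • b a)) j = (fun a => weightOp p (F (b a)) j) ⬝ᵥ c := by
  have h : ((F (∑ a, c a • b a) : Ell2) : ℕ → ℂ) = ∑ a, c a • (F (b a) : ℕ → ℂ) := by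
    rw [map_sum, lp.coeFn_sum]
    refine Finset.sum_congr rfl fun a _ => ?_
    rw [map_smul, lp.coeFn_smul]
  rw [h, map_sum, Finset.sum_apply, dotProduct]
  refine Finset.sum_congr rfl fun a _ => ?_
  rw [map_smul, Pi.smul_apply, smul_eq_mul, mul_comm]

lemma sampleMatrix_quadraticForm (F : Ell2 ≃ₗᵢ[ℂ] Ell2) (p : PMF ℕ) (b : Fin N → Ell2) (j : ℕ)
    (c : Fin N → ℂ) : star c ⬝ᵥ sampleMatrix F p b j *ᵥ c =
      ((‖weightOp p (F (∑ a, c a • b a)) j‖ ^ 2 : ℝ) : ℂ) := by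
  rw [sampleMatrix, vecMulVec_mulVec, weightOp_sum, dotProduct_smul, star_dotProduct_star,
    ← Complex.normSq_eq_norm_sq, Complex.normSq_eq_conj_mul_self]
  simp [dotProduct_comm, mul_comm]

lemma sampleMatrix_nonneg (F : Ell2 ≃ₗᵢ[ℂ] Ell2) (p : PMF ℕ) (b : Fin N → Ell2) (j : ℕ) :
    0 ≤ sampleMatrix F p b j :=
  (posSemidef_vecMulVec_star_self _).nonneg

lemma le_real_smul_one {A : Matrix (Fin N) (Fin N) ℂ} (hA : A.IsHermitian) {K : ℝ}
    (h : ∀ c, (star c ⬝ᵥ A *ᵥ c).re ≤ K * (star c ⬝ᵥ c).re) :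
    A ≤ K • (1 : Matrix (Fin N) (Fin N) ℂ) := by
  have hH : (K • (1 : Matrix (Fin N) (Fin N) ℂ) - A).IsHermitian :=
    (isHermitian_real_smul isHermitian_one K).sub hA
  refine le_iff.2 (PosSemidef.of_dotProduct_mulVec_nonneg hH fun c => ?_)
  refine Complex.le_def.2 ⟨?_, (hH.im_star_dotProduct_mulVec_self c).symm⟩
  rw [sub_mulVec, dotProduct_sub, smul_mulVec, one_mulVec, dotProduct_smul, Complex.real_smul,
    Complex.sub_re, Complex.re_ofReal_mul, Complex.zero_re, sub_nonneg]
  exact h c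

/-- The quadratic form of a matrix at `c` as a continuous linear functional of the matrix. -/
def quadraticFormAt (c : Fin N → ℂ) : Matrix (Fin N) (Fin N) ℂ →L[ℝ] ℝ :=
  LinearMap.toContinuousLinearMap
    { toFun := fun A => (star c ⬝ᵥ A *ᵥ c).re
      map_add' := fun A B => by rw [add_mulVec, dotProduct_add, Complex.add_re]
      map_smul' := fun r A => by
        rw [smul_mulVec, dotProduct_smul, Complex.real_smul, Complex.re_ofReal_mul]
        rfl }

lemma quadraticFormAt_apply (c : Fin N → ℂ) (A : Matrix (Fin N) (Fin N) ℂ) :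
    quadraticFormAt c A = (star c ⬝ᵥ A *ᵥ c).re := rfl

lemma quadraticFormAt_sampleMatrix (F : Ell2 ≃ₗᵢ[ℂ] Ell2) (p : PMF ℕ) (b : Fin N → Ell2) (j : ℕ)
    (c : Fin N → ℂ) : quadraticFormAt c (sampleMatrix F p b j) =
      ‖weightOp p (F (∑ a, c a • b a)) j‖ ^ 2 := by
  rw [quadraticFormAt_apply, sampleMatrix_quadraticForm, Complex.ofReal_re]

lemma sq_norm_sum_smul {b : Fin N → Ell2} (hb : Orthonormal ℂ b) (c : Fin N → ℂ) :
    (star c ⬝ᵥ c).re = ‖∑ a, c a • b a‖ ^ 2 := by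
  rw [← inner_self_eq_norm_sq (𝕜 := ℂ), hb.inner_sum c c Finset.univ]
  rfl

/-- The restricted isometry property of a random subsampled unitary on a fixed subspace. -/
theorem measure_not_satisfiesGenRIP_le (F : Ell2 ≃ₗᵢ[ℂ] Ell2) (p : PMF ℕ) (V : Submodule ℂ Ell2)
    [FiniteDimensional ℂ V] {K δ : ℝ} (hK : 1 ≤ K)
    (hV : ∀ x ∈ V, ∀ j, 0 < p j → ‖F x j‖ ^ 2 ≤ K * (p j).toReal * ‖x‖ ^ 2)
    (hδ0 : 0 < δ) (hδ1 : δ < 1) {m : ℕ} (hm : 0 < m) :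
    (Measure.pi fun _ : Fin m => p.toMeasure) {J | ¬ SatisfiesGenRIP F p J V δ} ≤
      ENNReal.ofReal (2 * Module.finrank ℂ V * Real.exp (-(m * δ ^ 2 / (4 * K)))) := by
  let B := stdOrthonormalBasis ℂ V
  let b : Fin (Module.finrank ℂ V) → Ell2 := fun a => (B a : Ell2)
  have hb : Orthonormal ℂ b := B.orthonormal.comp_linearIsometry V.subtypeₗᵢ
  have hbV : ∀ c : Fin (Module.finrank ℂ V) → ℂ, ∑ a, c a • b a ∈ V := fun c =>
    V.sum_mem fun a _ => V.smul_mem _ (B a).2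
  let X := sampleMatrix F p b
  have hX0 : ∀ j, 0 ≤ X j := sampleMatrix_nonneg F p b
  have hXK : ∀ j, X j ≤ K • 1 := by
    intro j
    refine le_real_smul_one (hX0 j).posSemidef.isHermitian fun c => ?_
    rw [← quadraticFormAt_apply, quadraticFormAt_sampleMatrix, sq_norm_sum_smul hb,
      sq_norm_weightOp]
    rcases eq_or_ne (p j) 0 with h | h
    · rw [h, ENNReal.toReal_zero, div_zero]
      positivity
    · have hp := ENNReal.toReal_pos h (p.apply_ne_top j)
      rw [div_le_iff₀ hp]
      have := hV _ (hbV c) j (pos_iff_ne_zero.2 h)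
      linarith
  have hint := integrable_of_nonneg_of_le (ν := p.toMeasure) hX0 hXK
  set M := ∫ j, X j ∂p.toMeasure with hMdef
  have hM0 : 0 ≤ M := integral_nonneg hX0
  -- The weights `1 / p j` cancel the sampling probabilities, so `M` represents `F* Î F` on `V`.
  have hMq : ∀ c, quadraticFormAt c M = ‖supportProj p (F (∑ a, c a • b a))‖ ^ 2 := by
    intro c
    rw [hMdef, ← (quadraticFormAt c).integral_comp_comm hint,
      PMF.integral_eq_tsum _ _ ((quadraticFormAt c).integrable_comp hint), sq_norm_supportProj]
    refine tsum_congr fun j => ?_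
    rw [quadraticFormAt_sampleMatrix, smul_eq_mul]
  have hM1 : M ≤ 1 := by
    rw [← one_smul ℝ (1 : Matrix _ _ ℂ)]
    refine le_real_smul_one hM0.posSemidef.isHermitian fun c => ?_
    rw [← quadraticFormAt_apply, hMq, sq_norm_sum_smul hb, one_mul]
    have := norm_supportProj_le p (F (∑ a, c a • b a))
    rw [LinearIsometryEquiv.norm_map] at this
    gcongr
  have key := measure_deviation_gt_le hK hX0 hXK hM1 hδ0 hδ1 m
  rw [Fintype.card_fin] at key
  refine (measure_mono ?_).trans key
  intro J hJ
  simp only [Set.mem_ofPred_eq, SatisfiesGenRIP, not_forall, not_le] at hJ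
  obtain ⟨x, hxV, hx1, hx⟩ := hJ
  let c : Fin (Module.finrank ℂ V) → ℂ := fun a => B.repr ⟨x, hxV⟩ a
  have hc : ∑ a, c a • b a = x := by
    have := congrArg (Submodule.subtype V) (B.sum_repr ⟨x, hxV⟩)
    simpa [c, b] using this
  refine ⟨c, ?_⟩
  rw [sq_norm_sum_smul hb, hc, hx1, ← quadraticFormAt_apply, map_sum]
  simp only [map_sub]
  rw [Finset.sum_sub_distrib]
  have e1 : ∑ i, quadraticFormAt c (X (J i)) = ‖samplingOp J (weightOp p (F x))‖ ^ 2 := by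
    rw [sq_norm_samplingOp]
    refine Finset.sum_congr rfl fun i _ => ?_
    rw [quadraticFormAt_sampleMatrix, hc]
  rw [e1, hMq, hc]
  have hm' : (0 : ℝ) < m := by exact_mod_cast hm
  have e2 : ‖samplingOp J (weightOp p (F x))‖ ^ 2 - ∑ _i : Fin m, ‖supportProj p (F x)‖ ^ 2 =
      m * (1 / (m : ℝ) * ‖samplingOp J (weightOp p (F x))‖ ^ 2 - ‖supportProj p (F x)‖ ^ 2) := by
    simp only [Finset.sum_const, Finset.card_univ, Fintype.card_fin, nsmul_eq_mul]
    field_simp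
  rw [e2, abs_mul, abs_of_pos hm', one_pow, mul_one]
  exact mul_lt_mul_of_pos_left hx hm'

end Subspace

/-! ### Coherence and dimension of cone spans. -/

section Coherence

lemma sq_norm_apply_le_mu (F : Ell2 ≃ₗᵢ[ℂ] Ell2) {U : Set Ell2} {p : PMF ℕ} (hμ : 1 ≤ mu F U p)
    (C : ConvexCone ℝ Ell2) (hC : (C : Set Ell2) ⊆ U) {x : Ell2}
    (hx : x ∈ Submodule.span ℂ (C : Set Ell2)) {j : ℕ} (hj : 0 < p j) :
    ‖F x j‖ ^ 2 ≤ mu F U p ^ 2 * (p j).toReal * ‖x‖ ^ 2 := by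
  have hne : (coherenceBounds F U p).Nonempty := by
    by_contra h
    rw [Set.not_nonempty_iff_eq_empty] at h
    rw [mu, h, Real.sInf_empty] at hμ
    linarith
  rcases eq_or_ne x 0 with rfl | hx0
  · simp
  have hxn : 0 < ‖x‖ := norm_pos_iff.2 hx0
  let y : Ell2 := ((‖x‖⁻¹ : ℝ) : ℂ) • x
  have hy1 : ‖y‖ = 1 := by
    simp only [y, norm_smul, Complex.norm_real, norm_inv, norm_norm]
    exact inv_mul_cancel₀ hxn.ne'
  have hyC : y ∈ coneSpan U := ⟨C, hC, Submodule.smul_mem _ _ hx⟩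
  -- A real supremum dominates its terms only if the set is bounded; here `1` is a bound because `F`
  -- is isometric.
  have hbdd : BddAbove (Set.range fun z : {z : Ell2 // z ∈ coneSpan U ∧ ‖z‖ = 1} => ‖F z.1 j‖) := by
    refine ⟨1, ?_⟩
    rintro _ ⟨z, rfl⟩
    have := lp.norm_apply_le_norm (p := 2) (by simp) (F z.1) j
    rwa [LinearIsometryEquiv.norm_map, z.2.2] at this
  have h1 : ‖F y j‖ ≤ localCoherence F U j := le_ciSup hbdd ⟨y, hyC, hy1⟩
  have h2 := h1.trans ((isLeast_mu F U p hne).1 j hj)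
  have h3 : ‖F y j‖ = ‖x‖⁻¹ * ‖F x j‖ := by
    rw [map_smul, lp.coeFn_smul, Pi.smul_apply, norm_smul, Complex.norm_real, norm_inv, norm_norm]
  rw [h3, inv_mul_le_iff₀ hxn] at h2
  calc ‖F x j‖ ^ 2 ≤ (‖x‖ * (mu F U p * Real.sqrt (p j).toReal)) ^ 2 := by gcongr
    _ = _ := by
      rw [mul_pow, mul_pow, Real.sq_sqrt ENNReal.toReal_nonneg]
      ring

lemma apply_mem_span_range_single {ι : Type*} [Fintype ι] [DecidableEq ι] (f : (ι → ℝ) →ₗ[ℝ] Ell2)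
    (z : ι → ℝ) : f z ∈ Submodule.span ℂ (Set.range fun i => f (Pi.single i 1)) := by
  have h : z = ∑ i, z i • Pi.single i (1 : ℝ) := by
    simp [← Pi.single_smul', Finset.univ_sum_single]
  rw [h, map_sum]
  refine Submodule.sum_mem _ fun i _ => ?_
  rw [map_smul]
  exact ((Submodule.span ℂ _).restrictScalars ℝ).smul_mem _ (Submodule.subset_span ⟨i, rfl⟩)

/-- The cone `f(C) - g(D)`. -/
def coneDifference {E : Type*} [AddCommGroup E] [Module ℝ E] (f g : E →ₗ[ℝ] Ell2)
    (C D : ConvexCone ℝ E) : ConvexCone ℝ Ell2 := C.map f + D.map (-g)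

lemma mem_coneDifference {E : Type*} [AddCommGroup E] [Module ℝ E] {f g : E →ₗ[ℝ] Ell2}
    {C D : ConvexCone ℝ E} {x : Ell2} :
    x ∈ coneDifference f g C D ↔ ∃ y ∈ C, ∃ z ∈ D, f y - g z = x := by
  simp [coneDifference, ConvexCone.mem_add, sub_eq_add_neg]

/-- The latent variables are real, so the images of the standard basis under `f` and `g` already
generate over `ℂ`. This yields dimension at most `2 k`. -/
lemma span_coneDifference_le {ι : Type*} [Fintype ι] [DecidableEq ι] (f g : (ι → ℝ) →ₗ[ℝ] Ell2)
    (C D : ConvexCone ℝ (ι → ℝ)) :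
    Submodule.span ℂ (coneDifference f g C D : Set Ell2) ≤ Submodule.span ℂ
      (Set.range (Sum.elim (fun i => f (Pi.single i 1)) fun i => g (Pi.single i 1))) := by
  refine Submodule.span_le.2 fun x hx => ?_
  obtain ⟨y, -, z, -, rfl⟩ := mem_coneDifference.1 hx
  rw [Set.Sum.elim_range]
  exact Submodule.sub_mem _
    (Submodule.span_mono Set.subset_union_left (apply_mem_span_range_single f y))
    (Submodule.span_mono Set.subset_union_right (apply_mem_span_range_single g z))

lemma finiteDimensional_span_coneDifference {ι : Type*} [Fintype ι] (f g : (ι → ℝ) →ₗ[ℝ] Ell2)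
    (C D : ConvexCone ℝ (ι → ℝ)) :
    FiniteDimensional ℂ (Submodule.span ℂ (coneDifference f g C D : Set Ell2)) := by
  classical
  have := FiniteDimensional.span_of_finite ℂ (Set.finite_range
    (Sum.elim (fun i => f (Pi.single i 1)) fun i => g (Pi.single i 1)))
  exact Submodule.finiteDimensional_of_le (span_coneDifference_le f g C D)

lemma finrank_span_coneDifference_le {ι : Type*} [Fintype ι] (f g : (ι → ℝ) →ₗ[ℝ] Ell2)
    (C D : ConvexCone ℝ (ι → ℝ)) :
    Module.finrank ℂ (Submodule.span ℂ (coneDifference f g C D : Set Ell2)) ≤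
      2 * Fintype.card ι := by
  classical
  have := FiniteDimensional.span_of_finite ℂ (Set.finite_range
    (Sum.elim (fun i => f (Pi.single i 1)) fun i => g (Pi.single i 1)))
  refine (Submodule.finrank_mono (span_coneDifference_le f g C D)).trans
    ((finrank_range_le_card _).trans ?_)
  rw [Fintype.card_sum, two_mul]

end Coherence

/-! ### Cone cover of the difference set; law of the samples. -/

section ConeCover

variable {k d : ℕ}

/-- The difference set of a network is covered by cones contained in it, at most
`(2 e k_d / k)^(2 k d)` in number, whose complex spans have dimension at most `2 k`. -/
theorem GenerativeNetwork.exists_cone_cover (G : GenerativeNetwork k d) :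
    ∃ (ι : Type) (_ : Fintype ι) (C : ι → ConvexCone ℝ Ell2),
      (∀ x ∈ G.differenceSet, ∃ a, x ∈ C a) ∧ (∀ a, (C a : Set Ell2) ⊆ G.differenceSet) ∧
      (∀ a, FiniteDimensional ℂ (Submodule.span ℂ (C a : Set Ell2))) ∧
      (∀ a, Module.finrank ℂ (Submodule.span ℂ (C a : Set Ell2)) ≤ 2 * k) ∧
      (Fintype.card ι : ℝ) ≤ (2 * Real.exp 1 * G.width d / k) ^ (2 * k * d) := by
  obtain ⟨ι, _, C, L, hcov, hlin, hcard⟩ := G.exists_linear_pieces d le_rfl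
  let f : ι → (Fin (G.width 0) → ℝ) →ₗ[ℝ] Ell2 := fun a => (G.final.restrictScalars ℝ) ∘ₗ L a
  have hf : ∀ a, ∀ z ∈ C a, G.eval z = f a z := by
    intro a z hz
    rw [GenerativeNetwork.eval, hlin a z hz]
    rfl
  -- One cone for each pair of linear pieces, which doubles the exponent `k d`.
  refine ⟨ι × ι, inferInstance, fun x => coneDifference (f x.1) (f x.2) (C x.1) (C x.2), ?_, ?_,
    fun x => finiteDimensional_span_coneDifference _ _ _ _, fun x => ?_, ?_⟩
  · rintro _ ⟨_, ⟨y, rfl⟩, _, ⟨z, rfl⟩, rfl⟩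
    obtain ⟨a, ha⟩ := hcov y
    obtain ⟨a', ha'⟩ := hcov z
    exact ⟨(a, a'), mem_coneDifference.2 ⟨y, ha, z, ha', by rw [hf a y ha, hf a' z ha']⟩⟩
  · rintro ⟨a, a'⟩ x hx
    obtain ⟨y, hy, z, hz, rfl⟩ := mem_coneDifference.1 hx
    exact ⟨G.eval y, ⟨y, rfl⟩, G.eval z, ⟨z, rfl⟩, by simp only [hf a y hy, hf a' z hz]⟩
  · refine (finrank_span_coneDifference_le _ _ _ _).trans ?_
    rw [Fintype.card_fin, G.width_zero]
  · rw [Fintype.card_prod, Nat.cast_mul]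
    calc _ ≤ ((2 * Real.exp 1 * G.width d / k) ^ k) ^ d *
          ((2 * Real.exp 1 * G.width d / k) ^ k) ^ d := by gcongr
      _ = _ := by rw [← pow_mul, ← pow_add]; congr 1; ring

lemma map_eq_pi_toMeasure {p : PMF ℕ} {m : ℕ} {Ω : Type*} [MeasurableSpace Ω] {P : Measure Ω}
    [IsProbabilityMeasure P] {J : Fin m → Ω → ℕ} (hJ_meas : ∀ i, Measurable (J i))
    (hJ_indep : iIndepFun J P) (hJ_law : ∀ i j, P {ω | J i ω = j} = p j) :
    P.map (fun ω i => J i ω) = Measure.pi fun _ => p.toMeasure := by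
  rw [hJ_indep.map_fun_eq_pi_map fun i => (hJ_meas i).aemeasurable]
  congr 1
  funext i
  refine Measure.ext_of_singleton fun j => ?_
  rw [Measure.map_apply (hJ_meas i) (measurableSet_singleton j),
    p.toMeasure_apply_singleton j (measurableSet_singleton j)]
  exact hJ_law i j

end ConeCover

end GenRIP

end

/-! ### Union bound over the cones. -/

theorem theorem4p3 {k d : ℕ} (G : GenRIP.GenerativeNetwork k d)
    (F : GenRIP.Ell2 ≃ₗᵢ[ℂ] GenRIP.Ell2) (p : PMF ℕ)
    {ε δ : ℝ} (hε : 0 < ε) (hδ₀ : 0 < δ) (hδ₁ : δ < 1)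
    {m : ℕ} {Ω : Type*} [MeasurableSpace Ω] (P : Measure Ω) [IsProbabilityMeasure P]
    (J : Fin m → Ω → ℕ) (hJ_meas : ∀ i, Measurable (J i)) (hJ_indep : iIndepFun J P)
    (hJ_law : ∀ i j, P {ω | J i ω = j} = p j)
    (hμ : 1 ≤ GenRIP.mu F G.differenceSet p)
    (hm : 4 * GenRIP.mu F G.differenceSet p ^ 2 / δ ^ 2 *
        (2 * k * d * Real.log (2 * Real.exp 1 * G.width d / k) + Real.log (4 * k / ε)) ≤ m) :
    ENNReal.ofReal (1 - ε) ≤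
      P {ω | GenRIP.SatisfiesGenRIP F p (fun i => J i ω) G.differenceSet δ} := by
  rcases le_or_gt 1 ε with hε1 | hε1
  · rw [ENNReal.ofReal_of_nonpos (by linarith)]
    exact zero_le
  have hk2 : 2 ≤ k := G.two_le
  have hk : (0 : ℝ) < k := by exact_mod_cast (by omega : 0 < k)
  have hk1 : (2 : ℝ) ≤ k := by exact_mod_cast hk2
  have hwk : (k : ℝ) ≤ G.width d := by
    have := G.width_le_of_le (Nat.zero_le d) le_rfl
    rw [G.width_zero] at this
    exact_mod_cast this
  set μ := GenRIP.mu F G.differenceSet p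
  set b : ℝ := 2 * Real.exp 1 * G.width d / k with hb
  have hb1 : 1 ≤ b := by
    rw [hb, le_div_iff₀ hk]
    nlinarith [Real.one_le_exp (zero_le_one : (0 : ℝ) ≤ 1)]
  have hb0 : 0 < b := zero_lt_one.trans_le hb1
  set T : ℝ := 2 * k * d * Real.log b + Real.log (4 * k / ε) with hT
  have hT0 : 0 < T := by
    have h1 : 0 < Real.log (4 * k / ε) := Real.log_pos (by rw [lt_div_iff₀ hε]; linarith)
    have h2 := Real.log_nonneg hb1
    positivity
  have hμ0 : 0 < μ := zero_lt_one.trans_le hμ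
  have hm0 : 0 < m := by
    have : (0 : ℝ) < m := lt_of_lt_of_le (by positivity) hm
    exact_mod_cast this
  -- The first factor pays for the number of cones; `4 k` is two tails times dimension at most `2
  -- k`.
  have hexp : Real.exp (-(m * δ ^ 2 / (4 * μ ^ 2))) ≤ (b ^ (2 * k * d))⁻¹ * (ε / (4 * k)) := by
    have h1 : T ≤ m * δ ^ 2 / (4 * μ ^ 2) := by
      rw [le_div_iff₀ (by positivity)]
      calc T * (4 * μ ^ 2) = 4 * μ ^ 2 / δ ^ 2 * T * δ ^ 2 := by field_simp
        _ ≤ m * δ ^ 2 := by gcongr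
    refine (Real.exp_le_exp.2 (neg_le_neg h1)).trans (le_of_eq ?_)
    rw [hT, neg_add, Real.exp_add, Real.exp_neg (Real.log _), Real.exp_log (by positivity), inv_div,
      Real.exp_neg]
    congr 2
    rw [show (2 * k * d * Real.log b : ℝ) = ((2 * k * d : ℕ) : ℝ) * Real.log b by push_cast; ring,
      Real.exp_nat_mul, Real.exp_log hb0]
  obtain ⟨ι, _, C, hcov, hsub, hfin, hrank, hcard⟩ := G.exists_cone_cover
  have hbad : ∀ a, (Measure.pi fun _ : Fin m => p.toMeasure)
      {I | ¬ GenRIP.SatisfiesGenRIP F p I (Submodule.span ℂ (C a : Set GenRIP.Ell2)) δ} ≤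
      ENNReal.ofReal ((b ^ (2 * k * d))⁻¹ * ε) := by
    intro a
    have := hfin a
    refine (GenRIP.measure_not_satisfiesGenRIP_le F p _ (K := μ ^ 2) (one_le_pow₀ hμ)
      (fun x hx j hj => GenRIP.sq_norm_apply_le_mu F hμ (C a) (hsub a) hx hj) hδ₀ hδ₁ hm0).trans ?_
    refine ENNReal.ofReal_le_ofReal ?_
    have hr : (Module.finrank ℂ (Submodule.span ℂ (C a : Set GenRIP.Ell2)) : ℝ) ≤ 2 * k := by
      exact_mod_cast hrank a
    calc _ ≤ 2 * (2 * k) * ((b ^ (2 * k * d))⁻¹ * (ε / (4 * k))) := by gcongr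
      _ = _ := by field_simp; ring
  have hmap := GenRIP.map_eq_pi_toMeasure hJ_meas hJ_indep hJ_law
  have hJ : Measurable fun ω i => J i ω := measurable_pi_lambda _ hJ_meas
  have hunion : P {ω | ¬ GenRIP.SatisfiesGenRIP F p (fun i => J i ω) G.differenceSet δ} ≤
      ENNReal.ofReal ε := by
    calc _ = (Measure.pi fun _ : Fin m => p.toMeasure)
          {I | ¬ GenRIP.SatisfiesGenRIP F p I G.differenceSet δ} := by
          rw [← hmap, Measure.map_apply hJ MeasurableSet.of_discrete]
          rfl
      _ ≤ (Measure.pi fun _ : Fin m => p.toMeasure) (⋃ a,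
          {I | ¬ GenRIP.SatisfiesGenRIP F p I (Submodule.span ℂ (C a : Set GenRIP.Ell2)) δ}) := by
          refine measure_mono fun I hI => ?_
          simp only [Set.mem_iUnion, Set.mem_ofPred_eq] at hI ⊢
          by_contra! h
          refine hI fun x hx hx1 => ?_
          obtain ⟨a, ha⟩ := hcov x hx
          exact h a x (Submodule.subset_span ha) hx1
      _ ≤ ∑ a, ENNReal.ofReal ((b ^ (2 * k * d))⁻¹ * ε) :=
          (measure_iUnion_fintype_le _ _).trans (Finset.sum_le_sum fun a _ => hbad a)
      _ = ENNReal.ofReal (Fintype.card ι * ((b ^ (2 * k * d))⁻¹ * ε)) := by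
          rw [Finset.sum_const, Finset.card_univ, nsmul_eq_mul,
            ENNReal.ofReal_mul (Nat.cast_nonneg _), ENNReal.ofReal_natCast]
      _ ≤ ENNReal.ofReal ε := by
          refine ENNReal.ofReal_le_ofReal ?_
          calc _ ≤ b ^ (2 * k * d) * ((b ^ (2 * k * d))⁻¹ * ε) := by gcongr
            _ = ε := by field_simp
  rw [ENNReal.ofReal_sub _ hε.le, ENNReal.ofReal_one, tsub_le_iff_right]
  refine le_trans ?_ (add_le_add_right hunion _)
  -- Subadditivity on the event and its complement suffices, so measurability of the event in `Ω`
  -- plays no role.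
  have h1 : (Set.univ : Set Ω) ⊆
      {ω | GenRIP.SatisfiesGenRIP F p (fun i => J i ω) G.differenceSet δ} ∪
      {ω | ¬ GenRIP.SatisfiesGenRIP F p (fun i => J i ω) G.differenceSet δ} :=
    fun ω _ => em _
  calc (1 : ENNReal) = P Set.univ := measure_univ.symm
    _ ≤ _ := (measure_mono h1).trans (measure_union_le _ _)
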